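/- Conventions. Write $[x,y]=xy-yx$ and $\{x,y\}=xy+yx$. Let $P_{BF}$ (the relative parabose set) be the associative unital $\mathbb{C}$-algebra generated by $B_i^{\pm},F_i^{\pm}$ ($i=1,2,\dots$) subject to the following relations, for all indices and all signs $\xi,\eta,\epsilon=\pm$ (read as $\pm1$ in coefficients): $$[\{B_i^{\xi},B_j^{\eta}\},B_k^{\epsilon}]=(\epsilon-\eta)\delta_{jk}B_i^{\xi}+(\epsilon-\xi)\delta_{ik}B_j^{\eta},$$ $$[[F_i^{\xi},F_j^{\eta}],F_k^{\epsilon}]=\tfrac12(\epsilon-\eta)^2\delta_{jk}F_i^{\xi}-\tfrac12(\epsilon-\xi)^2\delta_{ik}F_j^{\eta},$$ $$[\{B_k^{\xi},B_l^{\eta}\},F_m^{\epsilon}]=0,\qquad [[F_k^{\xi},F_l^{\eta}],B_m^{\epsilon}]=0,$$ $$[\{B_k^{\xi},F_m^{\eta}\},B_l^{\epsilon}]=(\epsilon-\xi)\delta_{kl}F_m^{\eta},\qquad \{\{B_m^{\xi},F_k^{\eta}\},F_l^{\epsilon}\}=\tfrac12(\epsilon-\eta)^2\delta_{kl}B_m^{\xi}.$$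 It is graded by $\mathbb{Z}_2\times\mathbb{Z}_2$ with $\deg B_i^{\pm}=(1,0)$ and $\deg F_i^{\pm}=(1,1)$; put $\theta(a,b)=(-1)^{a_1b_1+a_2b_2}$. Let $L_{00}\subset P_{BF}$ be the span of all $\{B_k^{\epsilon},B_l^{\eta}\}$ and $[F_\alpha^{\epsilon},F_\beta^{\eta}]$, let $L_{01}$ be the span of all $\{F_\alpha^{\epsilon},B_k^{\eta}\}$, and let $W\subset P_{BF}$ be the unital subalgebra generated by $L_{00}\oplus L_{01}$, graded by $\mathbb{Z}_2$ through $W_a=W\cap (P_{BF})_{(0,a)}$. For a finite abelian group $G$ and $\theta:G\times G\to\mathbb{C}$, a $\theta$-braided Hopf algebra is a $G$-graded algebra $H$ with degree-preserving $\Delta:H\to H\otimes H$, $\varepsilon:H\to\mathbb{C}$, $S:H\to H$ that satisfy coassociativity, the counit axioms and the antipode axioms, where $\varepsilon$ is an algebra map, $\Delta$ is a unital algebra map for the product $(x\otimes y)(z\otimes w)=\theta(\deg y,\deg z)\,xz\otimes yw$ on $H\otimes H$, and $S(xy)=\theta(\deg x,\deg y)\,S(y)S(x)$ for homogeneous $x,y$.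 A super-Hopf algebra is the case $G=\mathbb{Z}_2$, $\theta(a,b)=(-1)^{ab}$; homomorphisms of super-Hopf algebras are the degree-preserving algebra maps compatible with $\Delta$, $\varepsilon$ and $S$. **Theorem.** Let $L=L_0\oplus L_1$ be a complex Lie superalgebra of any dimension, with universal enveloping algebra $\mathbb{U}(L)$ ($\mathbb{Z}_2$-graded as usual), and let $$P(z)=\begin{pmatrix}A(z)&B(z)\\ C(z)&D(z)\end{pmatrix}\qquad(z\in L)$$ be a graded matrix representation of $L$ on $\mathbb{C}^{m|n}$: $P$ is linear, $B(X)=C(X)=0$ for even $X$, $A(Y)=D(Y)=0$ for odd $Y$, and $P(\langle x,y\rangle)=P(x)P(y)-(-1)^{\deg x\deg y}P(y)P(x)$ for homogeneous $x,y$. 1. There is exactly one homomorphism of unital associative algebras $J:\mathbb{U}(L)\to P_{BF}$ such that, for all $X\in L_0$ and $Y\in L_1$, $$J(X)=\tfrac12\sum_{k,l=1}^{m}A_{kl}(X)\{B_k^+,B_l^-\}+\tfrac12\sum_{\alpha,\beta=1}^{n}D_{\alpha\beta}(X)[F_\alpha^+,F_\beta^-],$$ $$J(Y)=\tfrac12\sum_{k=1}^{m}\sum_{\alpha=1}^{n}\Big(B_{k\alpha}(Y)\{B_k^+,F_\alpha^-\}+C_{\alpha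 k}(Y)\{F_\alpha^+,B_k^-\}\Big).$$ 2. There is exactly one super-Hopf structure on $\mathbb{U}(L)$ with $\Delta x=1\otimes x+x\otimes1$, $\varepsilon(x)=0$, $S(x)=-x$ for all $x\in L$, and exactly one $\theta$-braided Hopf structure on $P_{BF}$ given by the same formulas at all the generators $x=B_i^{\pm},F_i^{\pm}$. The structure maps of $P_{BF}$ restrict to a super-Hopf structure on $W$, the image of $J$ lies in $W$, and $J:\mathbb{U}(L)\to W$ is a homomorphism of super-Hopf algebras. -/

import Mathlib

open scoped TensorProduct DirectSum

/-! ## Algebras graded by the degree of words in homogeneous generators -/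

section Words

variable {G A : Type*} [AddCommGroup G] [Ring A]

/-- `HomogWord gen a x`: the element `x` is a product of generators (`gen b` being the set of
generators of degree `b`) whose degrees add up to `a`. -/
inductive HomogWord (gen : G → Set A) : G → A → Prop
  | one : HomogWord gen 0 1
  | mul {a b : G} {x y : A} (hx : x ∈ gen a) (hy : HomogWord gen b y) :
      HomogWord gen (a + b) (x * y)

theorem HomogWord.append {gen : G → Set A} {a b : G} {x y : A}
    (hx : HomogWord gen a x) (hy : HomogWord gen b y) : HomogWord gen (a + b) (x * y) := by
  induction hx with
  | one => simpa using hy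
  | mul h _ ih => rw [add_assoc, mul_assoc]; exact .mul h ih

variable [Algebra ℂ A]

/-- The span of all words of degree `a` in the generators. -/
def wordSpan (gen : G → Set A) (a : G) : Submodule ℂ A :=
  Submodule.span ℂ {x | HomogWord gen a x}

theorem mem_wordSpan_of_gen {gen : G → Set A} {a : G} {x : A} (hx : x ∈ gen a) :
    x ∈ wordSpan gen a := by
  refine Submodule.subset_span ?_
  simpa using HomogWord.mul hx HomogWord.one

instance wordSpan.gradedMonoid (gen : G → Set A) : SetLike.GradedMonoid (wordSpan gen) where
  one_mem := Submodule.subset_span HomogWord.one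
  mul_mem := by
    intro a b x y hx hy
    have h : x * y ∈ wordSpan gen a * wordSpan gen b := Submodule.mul_mem_mul hx hy
    rw [wordSpan, wordSpan, Submodule.span_mul_span] at h
    refine Submodule.span_mono ?_ h
    rintro _ ⟨u, hu, v, hv, rfl⟩
    exact HomogWord.append hu hv

variable [DecidableEq G]

theorem of_mul_of_wordSpan {gen : G → Set A} {a b c : G} (h : a + b = c) (x : wordSpan gen a)
    (y : wordSpan gen b) (hxy : (x : A) * y ∈ wordSpan gen c) :
    DirectSum.of (fun a => ↥(wordSpan gen a)) a x * DirectSum.of (fun a => ↥(wordSpan gen a)) b y =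
      DirectSum.of (fun a => ↥(wordSpan gen a)) c ⟨x * y, hxy⟩ := by
  subst h
  rw [DirectSum.of_mul_of]
  rfl

theorem of_eq_sub_smul {gen : G → Set A} {a : G} {u v w : A} (c : ℂ) (hu : u ∈ wordSpan gen a)
    (hv : v ∈ wordSpan gen a) (hw : w ∈ wordSpan gen a) (h : u = v - c • w) :
    DirectSum.of (fun a => ↥(wordSpan gen a)) a ⟨u, hu⟩ =
      DirectSum.of (fun a => ↥(wordSpan gen a)) a ⟨v, hv⟩ -
        c • DirectSum.of (fun a => ↥(wordSpan gen a)) a ⟨w, hw⟩ := by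
  subst h
  exact (map_sub (DirectSum.lof ℂ G (fun a => ↥(wordSpan gen a)) a) ⟨v, hv⟩ (c • ⟨w, hw⟩)).trans
    (congrArg _ (map_smul (DirectSum.lof ℂ G (fun a => ↥(wordSpan gen a)) a) c ⟨w, hw⟩))

/-- The word spans grade `A` as soon as some algebra map to their direct sum
puts every generator in its own degree and the generators generate. -/
@[reducible] noncomputable def gradedAlgebraOfWords (gen : G → Set A)
    (f : A →ₐ[ℂ] ⨁ a, wordSpan gen a)
    (hf : ∀ a x (hx : x ∈ gen a),
      f x = DirectSum.of (fun a => ↥(wordSpan gen a)) a ⟨x, mem_wordSpan_of_gen hx⟩)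
    (hgen : Algebra.adjoin ℂ (⋃ a, gen a) = ⊤) : GradedAlgebra (wordSpan gen) :=
  GradedAlgebra.ofAlgHom (wordSpan gen) f
    (by
      apply AlgHom.ext_of_adjoin_eq_top hgen
      intro x hx
      obtain ⟨a, ha⟩ := Set.mem_iUnion.1 hx
      simp [hf a x ha])
    (by
      have key : ∀ a x, HomogWord gen a x → ∀ h : x ∈ wordSpan gen a,
          f x = DirectSum.of (fun a => ↥(wordSpan gen a)) a ⟨x, h⟩ := by
        intro a x hx
        induction hx with
        | one => intro h; rw [map_one]; rfl
        | @mul a b x y hx hy ih =>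
          intro h
          rw [map_mul, hf _ _ hx, ih (Submodule.subset_span hy), DirectSum.of_mul_of]
          rfl
      rintro a ⟨x, hx⟩
      change f x = _
      have : ∀ h : x ∈ wordSpan gen a,
          f x = DirectSum.of (fun a => ↥(wordSpan gen a)) a ⟨x, h⟩ := by
        refine Submodule.span_induction
          (p := fun x _ => ∀ h : x ∈ wordSpan gen a,
            f x = DirectSum.of (fun a => ↥(wordSpan gen a)) a ⟨x, h⟩) ?_ ?_ ?_ ?_ hx
        · exact fun x hx h => key a x hx h
        · intro h
          rw [map_zero]
          exact (map_zero (DirectSum.of (fun a => ↥(wordSpan gen a)) a)).symm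
        · intro x y hx hy ihx ihy h
          rw [map_add, ihx hx, ihy hy, ← map_add]
          rfl
        · intro c x hx ihx h
          rw [map_smul, ihx hx]
          exact (map_smul (DirectSum.lof ℂ G (fun a => ↥(wordSpan gen a)) a) c ⟨x, hx⟩).symm
      exact this hx)

end Words

/-! ## Braided Hopf algebras -/

section BraidedHopf

variable {G : Type*} [AddCommGroup G] [Fintype G] [DecidableEq G]

/-- The multiplication `(x ⊗ y)(z ⊗ w) = θ(a, b) xz ⊗ yw`, for `y` of degree `a` and `z` of
degree `b`, on the tensor square of a graded algebra. -/
noncomputable def braidedMul (θ : G → G → ℂ) {A : Type*} [Ring A] [Algebra ℂ A]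
    (𝒜 : G → Submodule ℂ A) [GradedAlgebra 𝒜] (s t : A ⊗[ℂ] A) : A ⊗[ℂ] A :=
  ∑ a, ∑ b, θ a b • (TensorProduct.map LinearMap.id (GradedAlgebra.proj 𝒜 a) s *
    TensorProduct.map (GradedAlgebra.proj 𝒜 b) LinearMap.id t)

/-- The elements of degree `a` in the tensor square of a graded algebra. -/
def tensorGrade {A : Type*} [Ring A] [Algebra ℂ A] (𝒜 : G → Submodule ℂ A) (a : G) :
    Submodule ℂ (A ⊗[ℂ] A) :=
  Submodule.span ℂ {t | ∃ b c, b + c = a ∧ ∃ x ∈ 𝒜 b, ∃ y ∈ 𝒜 c, t = x ⊗ₜ[ℂ] y}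

/-- A `θ`-braided (`G`-graded) Hopf algebra structure on a graded algebra. -/
structure BraidedHopf (θ : G → G → ℂ) {A : Type*} [Ring A] [Algebra ℂ A]
    (𝒜 : G → Submodule ℂ A) [GradedAlgebra 𝒜] where
  comul : A →ₗ[ℂ] A ⊗[ℂ] A
  counit : A →ₐ[ℂ] ℂ
  antipode : A →ₗ[ℂ] A
  comul_mem : ∀ a, ∀ x ∈ 𝒜 a, comul x ∈ tensorGrade 𝒜 a
  counit_eq_zero : ∀ a, a ≠ 0 → ∀ x ∈ 𝒜 a, counit x = 0
  antipode_mem : ∀ a, ∀ x ∈ 𝒜 a, antipode x ∈ 𝒜 a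
  comul_one : comul 1 = 1 ⊗ₜ[ℂ] 1
  comul_mul : ∀ x y, comul (x * y) = braidedMul θ 𝒜 (comul x) (comul y)
  coassoc : (TensorProduct.assoc ℂ A A A).toLinearMap ∘ₗ comul.rTensor A ∘ₗ comul =
    comul.lTensor A ∘ₗ comul
  counit_comul : ∀ x, counit.toLinearMap.rTensor A (comul x) = 1 ⊗ₜ[ℂ] x
  comul_counit : ∀ x, counit.toLinearMap.lTensor A (comul x) = x ⊗ₜ[ℂ] 1
  antipode_left : ∀ x, LinearMap.mul' ℂ A (antipode.rTensor A (comul x)) =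
    algebraMap ℂ A (counit x)
  antipode_right : ∀ x, LinearMap.mul' ℂ A (antipode.lTensor A (comul x)) =
    algebraMap ℂ A (counit x)
  antipode_mul : ∀ a b, ∀ x ∈ 𝒜 a, ∀ y ∈ 𝒜 b,
    antipode (x * y) = θ a b • (antipode y * antipode x)

/-- The structure maps take the values
`Δ x = 1 ⊗ x + x ⊗ 1`, `ε x = 0`, `S x = -x` at the element `x`. -/
def BraidedHopf.PrimitiveAt {θ : G → G → ℂ} {A : Type*} [Ring A] [Algebra ℂ A]
    {𝒜 : G → Submodule ℂ A} [GradedAlgebra 𝒜] (H : BraidedHopf θ 𝒜) (x : A) : Prop :=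
  H.comul x = 1 ⊗ₜ[ℂ] x + x ⊗ₜ[ℂ] 1 ∧ H.counit x = 0 ∧ H.antipode x = -x

/-- Compatibility of an algebra map with the comultiplications, counits and antipodes. -/
structure PreservesHopf {G' : Type*} [AddCommGroup G'] [Fintype G'] [DecidableEq G']
    {θ : G → G → ℂ} {θ' : G' → G' → ℂ}
    {A : Type*} [Ring A] [Algebra ℂ A] {𝒜 : G → Submodule ℂ A} [GradedAlgebra 𝒜]
    {B : Type*} [Ring B] [Algebra ℂ B] {ℬ : G' → Submodule ℂ B} [GradedAlgebra ℬ]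
    (H : BraidedHopf θ 𝒜) (K : BraidedHopf θ' ℬ) (f : A →ₐ[ℂ] B) : Prop where
  comul : ∀ x, K.comul (f x) = TensorProduct.map f.toLinearMap f.toLinearMap (H.comul x)
  counit : ∀ x, K.counit (f x) = H.counit x
  antipode : ∀ x, K.antipode (f x) = f (H.antipode x)

/-- A homomorphism of braided (`G`-graded) Hopf algebras; for `G = ℤ/2` and the sign rule
these are the homomorphisms of super-Hopf algebras. -/
structure IsBraidedHopfHom {θ : G → G → ℂ}
    {A : Type*} [Ring A] [Algebra ℂ A] {𝒜 : G → Submodule ℂ A} [GradedAlgebra 𝒜]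
    {B : Type*} [Ring B] [Algebra ℂ B] {ℬ : G → Submodule ℂ B} [GradedAlgebra ℬ]
    (H : BraidedHopf θ 𝒜) (K : BraidedHopf θ ℬ) (f : A →ₐ[ℂ] B) : Prop
    extends PreservesHopf H K f where
  map_mem : ∀ a, ∀ x ∈ 𝒜 a, f x ∈ ℬ a

end BraidedHopf

/-! ## Lie superalgebras, their enveloping algebras and graded matrix representations -/

/-- The sign `(-1)^(ab)` for parities `a`, `b`. -/
def superSign (a b : ZMod 2) : ℂ := (-1) ^ (a * b).val

/-- A complex Lie superalgebra structure on the `ℤ/2`-graded vector space `L = 𝓛 0 ⊕ 𝓛 1`. -/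
structure LieSuperalgebra {L : Type*} [AddCommGroup L] [Module ℂ L]
    (𝓛 : ZMod 2 → Submodule ℂ L) [DirectSum.Decomposition 𝓛] where
  bracket : L →ₗ[ℂ] L →ₗ[ℂ] L
  bracket_mem : ∀ a b, ∀ x ∈ 𝓛 a, ∀ y ∈ 𝓛 b, bracket x y ∈ 𝓛 (a + b)
  skew : ∀ a b, ∀ x ∈ 𝓛 a, ∀ y ∈ 𝓛 b, bracket x y = -(superSign a b • bracket y x)
  jacobi : ∀ a b c, ∀ x ∈ 𝓛 a, ∀ y ∈ 𝓛 b, ∀ z ∈ 𝓛 c,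
    superSign c a • bracket x (bracket y z) + superSign b c • bracket z (bracket x y) +
      superSign a b • bracket y (bracket z x) = 0

section Enveloping

variable {L : Type*} [AddCommGroup L] [Module ℂ L] {𝓛 : ZMod 2 → Submodule ℂ L}
  [DirectSum.Decomposition 𝓛]

/-- The relations `⟨x, y⟩ = xy - (-1)^(deg x deg y) yx`, for homogeneous `x` and `y`. -/
inductive LieSuperalgebra.Rel (S : LieSuperalgebra 𝓛) :
    TensorAlgebra ℂ L → TensorAlgebra ℂ L → Prop
  | bracket (a b : ZMod 2) (x y : L) (hx : x ∈ 𝓛 a) (hy : y ∈ 𝓛 b) :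
      LieSuperalgebra.Rel S (TensorAlgebra.ι ℂ (S.bracket x y))
        (TensorAlgebra.ι ℂ x * TensorAlgebra.ι ℂ y -
          superSign a b • (TensorAlgebra.ι ℂ y * TensorAlgebra.ι ℂ x))

/-- The universal enveloping algebra of a Lie superalgebra. -/
def LieSuperalgebra.U (S : LieSuperalgebra 𝓛) : Type _ := RingQuot S.Rel

noncomputable instance LieSuperalgebra.instRingU (S : LieSuperalgebra 𝓛) : Ring S.U :=
  inferInstanceAs (Ring (RingQuot S.Rel))

noncomputable instance LieSuperalgebra.instAlgebraU (S : LieSuperalgebra 𝓛) : Algebra ℂ S.U :=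
  inferInstanceAs (Algebra ℂ (RingQuot S.Rel))

noncomputable def LieSuperalgebra.mkU (S : LieSuperalgebra 𝓛) : TensorAlgebra ℂ L →ₐ[ℂ] S.U :=
  RingQuot.mkAlgHom ℂ S.Rel

/-- The canonical map of a Lie superalgebra to its universal enveloping algebra. -/
noncomputable def LieSuperalgebra.ι (S : LieSuperalgebra 𝓛) : L →ₗ[ℂ] S.U :=
  S.mkU.toLinearMap ∘ₗ TensorAlgebra.ι ℂ

theorem LieSuperalgebra.ι_bracket (S : LieSuperalgebra 𝓛) {a b : ZMod 2} {x y : L}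
    (hx : x ∈ 𝓛 a) (hy : y ∈ 𝓛 b) :
    S.ι (S.bracket x y) = S.ι x * S.ι y - superSign a b • (S.ι y * S.ι x) := by
  have h := RingQuot.mkAlgHom_rel ℂ (LieSuperalgebra.Rel.bracket (S := S) a b x y hx hy)
  change S.mkU _ = S.mkU _ at h
  simpa [LieSuperalgebra.ι] using h

/-- The homogeneous generators of the enveloping algebra, with their parity. -/
def LieSuperalgebra.gen (S : LieSuperalgebra 𝓛) (a : ZMod 2) : Set S.U := {u | ∃ x ∈ 𝓛 a, u = S.ι x}

theorem LieSuperalgebra.ι_mem (S : LieSuperalgebra 𝓛) {a : ZMod 2} {x : L} (hx : x ∈ 𝓛 a) :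
    S.ι x ∈ wordSpan S.gen a :=
  mem_wordSpan_of_gen (gen := S.gen) ⟨x, hx, rfl⟩

/-- The `ℤ/2`-grading of the enveloping algebra: `grade a` is spanned by the products of
homogeneous elements of `L` whose parities add up to `a`. -/
noncomputable def LieSuperalgebra.grade (S : LieSuperalgebra 𝓛) : ZMod 2 → Submodule ℂ S.U := wordSpan S.gen

/-- The linear map `L → ⨁ grade a` that sends `x` to the sum of its homogeneous parts. -/
noncomputable def LieSuperalgebra.toGrade (S : LieSuperalgebra 𝓛) :
    L →ₗ[ℂ] ⨁ a, wordSpan S.gen a :=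
  (DirectSum.toModule ℂ (ZMod 2) (⨁ a, wordSpan S.gen a) fun a =>
    DirectSum.lof ℂ (ZMod 2) (fun a => ↥(wordSpan S.gen a)) a ∘ₗ
      (S.ι ∘ₗ (𝓛 a).subtype).codRestrict (wordSpan S.gen a)
        (fun x => S.ι_mem x.2)) ∘ₗ
    (DirectSum.decomposeLinearEquiv 𝓛).toLinearMap

theorem LieSuperalgebra.toGrade_of_mem (S : LieSuperalgebra 𝓛) {a : ZMod 2} {x : L}
    (hx : x ∈ 𝓛 a) : S.toGrade x =
      DirectSum.of (fun a => ↥(wordSpan S.gen a)) a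
        ⟨S.ι x, S.ι_mem hx⟩ := by
  have h : DirectSum.decompose 𝓛 x = DirectSum.lof ℂ (ZMod 2) (fun a => ↥(𝓛 a)) a ⟨x, hx⟩ :=
    DirectSum.decompose_of_mem 𝓛 hx
  simp only [LieSuperalgebra.toGrade, LinearMap.comp_apply, LinearEquiv.coe_coe,
    DirectSum.decomposeLinearEquiv_apply, h, DirectSum.toModule_lof]
  rfl

noncomputable def LieSuperalgebra.gradeHom (S : LieSuperalgebra 𝓛) :
    S.U →ₐ[ℂ] ⨁ a, wordSpan S.gen a :=
  RingQuot.liftAlgHom ℂ ⟨TensorAlgebra.lift ℂ S.toGrade, by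
    rintro _ _ ⟨a, b, x, y, hx, hy⟩
    have hxy : S.ι x * S.ι y ∈ wordSpan S.gen (a + b) :=
      SetLike.mul_mem_graded (S.ι_mem hx) (S.ι_mem hy)
    have hyx : S.ι y * S.ι x ∈ wordSpan S.gen (a + b) :=
      add_comm b a ▸ SetLike.mul_mem_graded (S.ι_mem hy) (S.ι_mem hx)
    simp only [map_sub, map_mul, map_smul, TensorAlgebra.lift_ι_apply]
    rw [S.toGrade_of_mem hx, S.toGrade_of_mem hy, S.toGrade_of_mem (S.bracket_mem a b x hx y hy),
      of_mul_of_wordSpan rfl _ _ hxy, of_mul_of_wordSpan (add_comm b a) _ _ hyx]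
    exact of_eq_sub_smul _ _ hxy hyx (S.ι_bracket hx hy)⟩

noncomputable instance LieSuperalgebra.gradedAlgebra (S : LieSuperalgebra 𝓛) :
    GradedAlgebra S.grade :=
  gradedAlgebraOfWords S.gen S.gradeHom
    (by
      rintro a _ ⟨x, hx, rfl⟩
      rw [← S.toGrade_of_mem hx]
      exact (RingQuot.liftAlgHom_mkAlgHom_apply ℂ _ _ _).trans (TensorAlgebra.lift_ι_apply _ _))
    (by
      rw [eq_top_iff]
      rintro u -
      obtain ⟨t, rfl⟩ := RingQuot.mkAlgHom_surjective ℂ S.Rel u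
      induction t using TensorAlgebra.induction with
      | algebraMap r => rw [AlgHom.commutes]; exact Subalgebra.algebraMap_mem _ r
      | ι x =>
        classical
        rw [← DirectSum.sum_support_decompose 𝓛 x, map_sum, map_sum]
        refine Subalgebra.sum_mem _ fun a _ => Algebra.subset_adjoin ?_
        exact Set.mem_iUnion.2 ⟨a, _, (DirectSum.decompose 𝓛 x a).2, rfl⟩
      | mul x y hx hy => rw [map_mul]; exact Subalgebra.mul_mem _ hx hy
      | add x y hx hy => rw [map_add]; exact Subalgebra.add_mem _ hx hy)

/-- A graded matrix representation on `ℂ^(m|n)`: even elements act by block diagonal matrices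
`(A 0; 0 D)`, odd ones by matrices `(0 B; C 0)`, and brackets go to supercommutators. -/
structure GradedMatrixRep (S : LieSuperalgebra 𝓛) (m n : ℕ) where
  toFun : L →ₗ[ℂ] Matrix (Fin m ⊕ Fin n) (Fin m ⊕ Fin n) ℂ
  even : ∀ x ∈ 𝓛 0, (toFun x).toBlocks₁₂ = 0 ∧ (toFun x).toBlocks₂₁ = 0
  odd : ∀ y ∈ 𝓛 1, (toFun y).toBlocks₁₁ = 0 ∧ (toFun y).toBlocks₂₂ = 0
  map_bracket : ∀ a b, ∀ x ∈ 𝓛 a, ∀ y ∈ 𝓛 b, toFun (S.bracket x y) =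
    toFun x * toFun y - superSign a b • (toFun y * toFun x)

namespace GradedMatrixRep

variable {S : LieSuperalgebra 𝓛} {m n : ℕ} (P : GradedMatrixRep S m n)

def A (z : L) : Matrix (Fin m) (Fin m) ℂ := (P.toFun z).toBlocks₁₁

def B (z : L) : Matrix (Fin m) (Fin n) ℂ := (P.toFun z).toBlocks₁₂

def C (z : L) : Matrix (Fin n) (Fin m) ℂ := (P.toFun z).toBlocks₂₁

def D (z : L) : Matrix (Fin n) (Fin n) ℂ := (P.toFun z).toBlocks₂₂

end GradedMatrixRep

end Enveloping

/-! ## The relative parabose set -/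

/-- The commutator `xy - yx`. -/
def ringComm {R : Type*} [Ring R] (x y : R) : R := x * y - y * x

/-- The anticommutator `xy + yx`. -/
def antiComm {R : Type*} [Ring R] (x y : R) : R := x * y + y * x

/-- The generators `B_i^ξ` (parabosons) and `F_i^ξ` (parafermions), `ξ = ±1`; the index `i`
runs over the natural numbers. -/
inductive ParaGen : Type
  | B (i : ℕ) (ξ : ℤˣ) : ParaGen
  | F (i : ℕ) (ξ : ℤˣ) : ParaGen

namespace ParaGen

/-- The sign `ξ = ±1` as a complex number. -/
def sgn (ξ : ℤˣ) : ℂ := ((ξ : ℤ) : ℂ)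

/-- The Kronecker delta. -/
def delta (i j : ℕ) : ℂ := if i = j then 1 else 0

noncomputable def b (i : ℕ) (ξ : ℤˣ) : FreeAlgebra ℂ ParaGen := FreeAlgebra.ι ℂ (B i ξ)

noncomputable def f (i : ℕ) (ξ : ℤˣ) : FreeAlgebra ℂ ParaGen := FreeAlgebra.ι ℂ (F i ξ)

/-- The trilinear relations: the parabose and the parafermi relations, and the mixed relations
of the relative parabose set (each family of mixed relations is written uniformly in the signs;
the right hand sides are `0` unless the two signs that are compared are opposite). -/
inductive Rel : FreeAlgebra ℂ ParaGen → FreeAlgebra ℂ ParaGen → Prop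
  | bbb (i j k : ℕ) (ξ η ε : ℤˣ) :
      Rel (ringComm (antiComm (b i ξ) (b j η)) (b k ε))
        (((sgn ε - sgn η) * delta j k) • b i ξ + ((sgn ε - sgn ξ) * delta i k) • b j η)
  | fff (i j k : ℕ) (ξ η ε : ℤˣ) :
      Rel (ringComm (ringComm (f i ξ) (f j η)) (f k ε))
        ((1 / 2 * (sgn ε - sgn η) ^ 2 * delta j k) • f i ξ -
          (1 / 2 * (sgn ε - sgn ξ) ^ 2 * delta i k) • f j η)
  | bbf (k l m : ℕ) (ξ η ε : ℤˣ) : Rel (ringComm (antiComm (b k ξ) (b l η)) (f m ε)) 0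
  | ffb (k l m : ℕ) (ξ η ε : ℤˣ) : Rel (ringComm (ringComm (f k ξ) (f l η)) (b m ε)) 0
  | bfb (k l m : ℕ) (ξ η ε : ℤˣ) :
      Rel (ringComm (antiComm (b k ξ) (f m η)) (b l ε)) (((sgn ε - sgn ξ) * delta k l) • f m η)
  | bff (k l m : ℕ) (ξ η ε : ℤˣ) :
      Rel (antiComm (antiComm (b m ξ) (f k η)) (f l ε))
        ((1 / 2 * (sgn ε - sgn η) ^ 2 * delta k l) • b m ξ)

/-- The degrees `deg B_i^± = (1, 0)` and `deg F_i^± = (1, 1)`. -/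
def deg : ParaGen → ZMod 2 × ZMod 2
  | B _ _ => (1, 0)
  | F _ _ => (1, 1)

end ParaGen

/-- The relative parabose set, as an associative algebra. -/
def PBF : Type := RingQuot ParaGen.Rel

noncomputable instance PBF.instRing : Ring PBF := inferInstanceAs (Ring (RingQuot ParaGen.Rel))

noncomputable instance PBF.instAlgebra : Algebra ℂ PBF :=
  inferInstanceAs (Algebra ℂ (RingQuot ParaGen.Rel))

namespace PBF

noncomputable def mk : FreeAlgebra ℂ ParaGen →ₐ[ℂ] PBF := RingQuot.mkAlgHom ℂ ParaGen.Rel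

noncomputable def ι (g : ParaGen) : PBF := mk (FreeAlgebra.ι ℂ g)

/-- The generators `B_i^ξ`. -/
noncomputable def B (i : ℕ) (ξ : ℤˣ) : PBF := ι (.B i ξ)

/-- The generators `F_i^ξ`. -/
noncomputable def F (i : ℕ) (ξ : ℤˣ) : PBF := ι (.F i ξ)

/-- The commutation factor `θ(a, b) = (-1)^(a₁ b₁ + a₂ b₂)`. -/
def θ (a b : ZMod 2 × ZMod 2) : ℂ := (-1) ^ (a.1 * b.1 + a.2 * b.2).val

/-- The generators of degree `a`. -/
def gen (a : ZMod 2 × ZMod 2) : Set PBF := {u | ∃ g : ParaGen, g.deg = a ∧ u = ι g}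

/-- The `(ℤ/2 × ℤ/2)`-grading: `grade a` is spanned by the monomials of degree `a`. -/
noncomputable def grade : ZMod 2 × ZMod 2 → Submodule ℂ PBF := wordSpan gen

noncomputable def freeGradeHom : FreeAlgebra ℂ ParaGen →ₐ[ℂ] ⨁ a, wordSpan gen a :=
  FreeAlgebra.lift ℂ fun g => DirectSum.of (fun a => ↥(wordSpan gen a)) g.deg
    ⟨ι g, mem_wordSpan_of_gen ⟨g, rfl, rfl⟩⟩

/-- `x` maps to the degree `a` part of the direct sum. -/
def Pure (a : ZMod 2 × ZMod 2) (x : FreeAlgebra ℂ ParaGen) : Prop :=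
  ∃ h : mk x ∈ wordSpan gen a,
    freeGradeHom x = DirectSum.of (fun a => ↥(wordSpan gen a)) a ⟨mk x, h⟩

theorem Pure.zero (a : ZMod 2 × ZMod 2) : Pure a 0 := by
  refine ⟨by simp, ?_⟩
  rw [map_zero]
  refine Eq.trans (map_zero (DirectSum.of (fun a => ↥(wordSpan gen a)) a)).symm ?_
  congr 1
  exact Subtype.ext (map_zero mk).symm

theorem Pure.add {a : ZMod 2 × ZMod 2} {x y : FreeAlgebra ℂ ParaGen}
    (hx : Pure a x) (hy : Pure a y) : Pure a (x + y) := by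
  obtain ⟨h, hx⟩ := hx
  obtain ⟨k, hy⟩ := hy
  refine ⟨by rw [map_add]; exact Submodule.add_mem _ h k, ?_⟩
  rw [map_add, hx, hy, ← map_add]
  congr 1
  exact Subtype.ext (map_add mk x y).symm

theorem Pure.smul {a : ZMod 2 × ZMod 2} {x : FreeAlgebra ℂ ParaGen} (c : ℂ)
    (hx : Pure a x) : Pure a (c • x) := by
  obtain ⟨h, hx⟩ := hx
  refine ⟨by rw [map_smul]; exact Submodule.smul_mem _ c h, ?_⟩
  rw [map_smul, hx]
  refine Eq.trans (map_smul (DirectSum.lof ℂ _ (fun a => ↥(wordSpan gen a)) a) c ⟨mk x, h⟩).symm ?_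
  change DirectSum.of (fun a => ↥(wordSpan gen a)) a _ = _
  congr 1
  exact Subtype.ext (map_smul mk c x).symm

theorem Pure.sub {a : ZMod 2 × ZMod 2} {x y : FreeAlgebra ℂ ParaGen}
    (hx : Pure a x) (hy : Pure a y) : Pure a (x - y) := by
  have := hx.add (hy.smul (-1))
  rwa [neg_one_smul, ← sub_eq_add_neg] at this

theorem Pure.mul {a b : ZMod 2 × ZMod 2} {x y : FreeAlgebra ℂ ParaGen}
    (hx : Pure a x) (hy : Pure b y) : Pure (a + b) (x * y) := by
  obtain ⟨h, hx⟩ := hx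
  obtain ⟨k, hy⟩ := hy
  refine ⟨by rw [map_mul]; exact SetLike.mul_mem_graded h k, ?_⟩
  rw [map_mul, hx, hy, DirectSum.of_mul_of]
  congr 1
  exact Subtype.ext (map_mul mk x y).symm

theorem Pure.comm {a b : ZMod 2 × ZMod 2} {x y : FreeAlgebra ℂ ParaGen}
    (hx : Pure a x) (hy : Pure b y) : Pure (a + b) (ringComm x y) :=
  (hx.mul hy).sub (add_comm b a ▸ hy.mul hx)

theorem Pure.acomm {a b : ZMod 2 × ZMod 2} {x y : FreeAlgebra ℂ ParaGen}
    (hx : Pure a x) (hy : Pure b y) : Pure (a + b) (antiComm x y) :=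
  (hx.mul hy).add (add_comm b a ▸ hy.mul hx)

theorem pure_ι (g : ParaGen) : Pure g.deg (FreeAlgebra.ι ℂ g) :=
  ⟨mem_wordSpan_of_gen (gen := gen) ⟨g, rfl, rfl⟩, FreeAlgebra.lift_ι_apply _ g⟩

theorem pure_b (i : ℕ) (ξ : ℤˣ) : Pure (1, 0) (ParaGen.b i ξ) := pure_ι (.B i ξ)

theorem pure_f (i : ℕ) (ξ : ℤˣ) : Pure (1, 1) (ParaGen.f i ξ) := pure_ι (.F i ξ)

theorem mk_eq_of_rel {x y : FreeAlgebra ℂ ParaGen} (h : ParaGen.Rel x y) : mk x = mk y :=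
  RingQuot.mkAlgHom_rel ℂ h

theorem freeGradeHom_eq {a b : ZMod 2 × ZMod 2} {x y : FreeAlgebra ℂ ParaGen}
    (h : ParaGen.Rel x y) (hx : Pure a x) (hy : Pure b y) (hab : a = b) :
    freeGradeHom x = freeGradeHom y := by
  subst hab
  obtain ⟨_, hx⟩ := hx
  obtain ⟨_, hy⟩ := hy
  rw [hx, hy]
  congr 1
  exact Subtype.ext (mk_eq_of_rel h)

noncomputable def gradeHom : PBF →ₐ[ℂ] ⨁ a, wordSpan gen a :=
  RingQuot.liftAlgHom ℂ ⟨freeGradeHom, by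
    intro x y h
    cases h with
    | bbb i j k ξ η ε =>
      exact freeGradeHom_eq (.bbb i j k ξ η ε) (((pure_b i ξ).acomm (pure_b j η)).comm (pure_b k ε))
        (((pure_b i ξ).smul _).add ((pure_b j η).smul _)) (by decide)
    | fff i j k ξ η ε =>
      exact freeGradeHom_eq (.fff i j k ξ η ε) (((pure_f i ξ).comm (pure_f j η)).comm (pure_f k ε))
        (((pure_f i ξ).smul _).sub ((pure_f j η).smul _)) (by decide)
    | bbf k l m ξ η ε =>
      exact freeGradeHom_eq (.bbf k l m ξ η ε) (((pure_b k ξ).acomm (pure_b l η)).comm (pure_f m ε))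
        (Pure.zero _) rfl
    | ffb k l m ξ η ε =>
      exact freeGradeHom_eq (.ffb k l m ξ η ε) (((pure_f k ξ).comm (pure_f l η)).comm (pure_b m ε))
        (Pure.zero _) rfl
    | bfb k l m ξ η ε =>
      exact freeGradeHom_eq (.bfb k l m ξ η ε) (((pure_b k ξ).acomm (pure_f m η)).comm (pure_b l ε))
        ((pure_f m η).smul _) (by decide)
    | bff k l m ξ η ε =>
      exact freeGradeHom_eq (.bff k l m ξ η ε) (((pure_b m ξ).acomm (pure_f k η)).acomm (pure_f l ε))
        ((pure_b m ξ).smul _) (by decide)⟩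

noncomputable instance gradedAlgebra : GradedAlgebra grade :=
  gradedAlgebraOfWords gen gradeHom
    (by
      rintro a _ ⟨g, rfl, rfl⟩
      exact (RingQuot.liftAlgHom_mkAlgHom_apply ℂ _ _ _).trans (FreeAlgebra.lift_ι_apply _ _))
    (by
      rw [eq_top_iff]
      rintro u -
      obtain ⟨t, rfl⟩ := RingQuot.mkAlgHom_surjective ℂ ParaGen.Rel u
      induction t using FreeAlgebra.induction with
      | grade0 r => rw [AlgHom.commutes]; exact Subalgebra.algebraMap_mem _ r
      | grade1 g => exact Algebra.subset_adjoin (Set.mem_iUnion.2 ⟨g.deg, g, rfl, rfl⟩)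
      | mul x y hx hy => rw [map_mul]; exact Subalgebra.mul_mem _ hx hy
      | add x y hx hy => rw [map_add]; exact Subalgebra.add_mem _ hx hy)

/-- The subspace `L₀₀`, spanned by all `{B_k^ε, B_l^η}` and `[F_α^ε, F_β^η]`. -/
noncomputable def L00 : Submodule ℂ PBF :=
  Submodule.span ℂ {u | (∃ k l ε η, u = antiComm (B k ε) (B l η)) ∨
    ∃ α β ε η, u = ringComm (F α ε) (F β η)}

/-- The subspace `L₀₁`, spanned by all `{F_α^ε, B_k^η}`. -/
noncomputable def L01 : Submodule ℂ PBF :=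
  Submodule.span ℂ {u | ∃ α k ε η, u = antiComm (F α ε) (B k η)}

/-- The subalgebra of the relative parabose set that is generated by `L₀₀ ⊕ L₀₁`. -/
noncomputable def W : Subalgebra ℂ PBF := Algebra.adjoin ℂ ((L00 : Set PBF) ∪ (L01 : Set PBF))

/-- The `ℤ/2`-grading of `W`: the elements of `W` of degree `(0, a)`. -/
noncomputable def gradeW (a : ZMod 2) : Submodule ℂ W := (grade (0, a)).comap W.val.toLinearMap

theorem B_mem (i : ℕ) (ξ : ℤˣ) : B i ξ ∈ grade (1, 0) :=
  mem_wordSpan_of_gen (gen := gen) ⟨.B i ξ, rfl, rfl⟩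

theorem F_mem (i : ℕ) (ξ : ℤˣ) : F i ξ ∈ grade (1, 1) :=
  mem_wordSpan_of_gen (gen := gen) ⟨.F i ξ, rfl, rfl⟩

theorem comm_mem {a b : ZMod 2 × ZMod 2} {x y : PBF} (hx : x ∈ grade a) (hy : y ∈ grade b) :
    ringComm x y ∈ grade (a + b) :=
  Submodule.sub_mem _ (SetLike.mul_mem_graded hx hy)
    (add_comm b a ▸ SetLike.mul_mem_graded hy hx)

theorem acomm_mem {a b : ZMod 2 × ZMod 2} {x y : PBF} (hx : x ∈ grade a) (hy : y ∈ grade b) :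
    antiComm x y ∈ grade (a + b) :=
  Submodule.add_mem _ (SetLike.mul_mem_graded hx hy)
    (add_comm b a ▸ SetLike.mul_mem_graded hy hx)

theorem L00_le : L00 ≤ grade (0, 0) := by
  refine Submodule.span_le.2 ?_
  rintro _ (⟨k, l, ε, η, rfl⟩ | ⟨k, l, ε, η, rfl⟩)
  · have h := acomm_mem (B_mem k ε) (B_mem l η)
    rwa [show ((1, 0) : ZMod 2 × ZMod 2) + (1, 0) = (0, 0) by decide] at h
  · have h := comm_mem (F_mem k ε) (F_mem l η)
    rwa [show ((1, 1) : ZMod 2 × ZMod 2) + (1, 1) = (0, 0) by decide] at h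

theorem L01_le : L01 ≤ grade (0, 1) := by
  refine Submodule.span_le.2 ?_
  rintro _ ⟨k, l, ε, η, rfl⟩
  have h := acomm_mem (F_mem k ε) (B_mem l η)
  rwa [show ((1, 1) : ZMod 2 × ZMod 2) + (1, 0) = (0, 1) by decide] at h

theorem mul_mem_grade {a b c : ZMod 2 × ZMod 2} {x y : PBF} (hx : x ∈ grade a)
    (hy : y ∈ grade b) (h : a + b = c) : x * y ∈ grade c :=
  h ▸ SetLike.mul_mem_graded hx hy

theorem exists_add_of_mem_W {w : PBF} (hw : w ∈ W) :
    ∃ u ∈ W, u ∈ grade (0, 0) ∧ ∃ v ∈ W, v ∈ grade (0, 1) ∧ w = u + v := by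
  induction hw using Algebra.adjoin_induction with
  | mem x hx =>
    have hxW : x ∈ W := Algebra.subset_adjoin hx
    rcases hx with hx | hx
    · exact ⟨x, hxW, L00_le hx, 0, W.zero_mem, Submodule.zero_mem _, by simp⟩
    · exact ⟨0, W.zero_mem, Submodule.zero_mem _, x, hxW, L01_le hx, by simp⟩
  | algebraMap r =>
    exact ⟨algebraMap ℂ PBF r, W.algebraMap_mem r, SetLike.algebraMap_mem_graded grade r, 0, W.zero_mem,
      Submodule.zero_mem _, by simp⟩
  | add x y _ _ ihx ihy =>
    obtain ⟨u, hu, hu', v, hv, hv', rfl⟩ := ihx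
    obtain ⟨s, hs, hs', t, ht, ht', rfl⟩ := ihy
    exact ⟨u + s, W.add_mem hu hs, Submodule.add_mem _ hu' hs', v + t, W.add_mem hv ht,
      Submodule.add_mem _ hv' ht', by abel⟩
  | mul x y _ _ ihx ihy =>
    obtain ⟨u, hu, hu', v, hv, hv', rfl⟩ := ihx
    obtain ⟨s, hs, hs', t, ht, ht', rfl⟩ := ihy
    exact ⟨u * s + v * t, W.add_mem (W.mul_mem hu hs) (W.mul_mem hv ht),
      Submodule.add_mem _ (mul_mem_grade hu' hs' (by decide)) (mul_mem_grade hv' ht' (by decide)),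
      u * t + v * s, W.add_mem (W.mul_mem hu ht) (W.mul_mem hv hs),
      Submodule.add_mem _ (mul_mem_grade hu' ht' (by decide)) (mul_mem_grade hv' hs' (by decide)),
      by rw [add_mul, mul_add, mul_add]; abel⟩

theorem proj_mem_W {w : PBF} (hw : w ∈ W) (a : ZMod 2) :
    GradedAlgebra.proj grade (0, a) w ∈ W := by
  obtain ⟨u, hu, hu', v, hv, hv', rfl⟩ := exists_add_of_mem_W hw
  rw [map_add]
  have h : ∀ b : ZMod 2, ∀ x ∈ W, x ∈ grade (0, b) → GradedAlgebra.proj grade (0, a) x ∈ W := by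
    intro b x hx hx'
    by_cases hab : b = a
    · subst hab
      rw [GradedAlgebra.proj_apply, DirectSum.decompose_of_mem_same _ hx']
      exact hx
    · rw [GradedAlgebra.proj_apply, DirectSum.decompose_of_mem_ne _ hx' (by simpa using hab)]
      exact W.zero_mem
  exact W.add_mem (h _ _ hu hu') (h _ _ hv hv')

/-- The degree `(0, a)` part, as a map from `W` to `gradeW a`. -/
noncomputable def partW (a : ZMod 2) : W →ₗ[ℂ] gradeW a :=
  LinearMap.codRestrict (gradeW a)
    (LinearMap.codRestrict (Subalgebra.toSubmodule W)
      (GradedAlgebra.proj grade (0, a) ∘ₗ W.val.toLinearMap) fun w => proj_mem_W w.2 a)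
    fun w => (DirectSum.decompose grade (w : PBF) (0, a)).2

theorem coe_partW (a : ZMod 2) (w : W) :
    ((partW a w : W) : PBF) = DirectSum.decompose grade (w : PBF) (0, a) := rfl

instance gradedMonoidW : SetLike.GradedMonoid gradeW where
  one_mem := SetLike.one_mem_graded grade
  mul_mem := by
    intro a b x y hx hy
    exact mul_mem_grade (c := (0, a + b)) hx hy (by simp)

noncomputable instance decompositionW : DirectSum.Decomposition gradeW :=
    DirectSum.Decomposition.ofLinearMap gradeW
      (∑ a, DirectSum.lof ℂ (ZMod 2) (fun a => ↥(gradeW a)) a ∘ₗ partW a)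
      (by
        ext w
        obtain ⟨u, hu, hu', v, hv, hv', h⟩ := exists_add_of_mem_W w.2
        have h0 : (DirectSum.decompose grade (w : PBF) (0, 0) : PBF) = u := by
          rw [h, DirectSum.decompose_add, DirectSum.add_apply, Submodule.coe_add,
            DirectSum.decompose_of_mem_same _ hu', DirectSum.decompose_of_mem_ne _ hv' (by simp),
            add_zero]
        have h1 : (DirectSum.decompose grade (w : PBF) (0, 1) : PBF) = v := by
          rw [h, DirectSum.decompose_add, DirectSum.add_apply, Submodule.coe_add,
            DirectSum.decompose_of_mem_same _ hv', DirectSum.decompose_of_mem_ne _ hu' (by simp),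
            zero_add]
        have hs : (Finset.univ : Finset (ZMod 2)) = {0, 1} := rfl
        rw [hs, Finset.sum_pair (zero_ne_one' (ZMod 2)), LinearMap.comp_apply,
          LinearMap.add_apply, map_add, LinearMap.comp_apply, LinearMap.comp_apply,
          DirectSum.coeLinearMap_lof, DirectSum.coeLinearMap_lof, Subalgebra.coe_add, coe_partW,
          coe_partW, h0, h1]
        exact h.symm)
      (by
        ext a x : 2
        have hx : ((x : W) : PBF) ∈ grade (0, a) := x.2
        have h : ∀ b, partW b (x : W) = if hb : a = b then hb ▸ x else 0 := by
          intro b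
          by_cases hb : a = b
          · subst hb
            simp only [dite_true]
            apply Subtype.ext
            apply Subtype.ext
            rw [coe_partW, DirectSum.decompose_of_mem_same _ hx]
          · simp only [hb, dite_false]
            apply Subtype.ext
            apply Subtype.ext
            rw [coe_partW, DirectSum.decompose_of_mem_ne _ hx (by simpa using hb)]
            rfl
        simp only [LinearMap.comp_apply, LinearMap.sum_apply, DirectSum.coeLinearMap_lof,
          LinearMap.id_apply]
        rw [Finset.sum_eq_single a]
        · rw [h a]; simp
        · intro b _ hb
          rw [h b, dif_neg (Ne.symm hb), map_zero]
        · simp)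

noncomputable instance gradedAlgebraW : GradedAlgebra gradeW where

end PBF

/-- The map `J` takes the prescribed values on the even and on the odd elements of `L`:
`J X = ½ ∑ A_kl(X) {B_k^+, B_l^-} + ½ ∑ D_αβ(X) [F_α^+, F_β^-]` and
`J Y = ½ ∑ (B_kα(Y) {B_k^+, F_α^-} + C_αk(Y) {F_α^+, B_k^-})`. -/
def IsParaRealization {L : Type*} [AddCommGroup L] [Module ℂ L] {𝓛 : ZMod 2 → Submodule ℂ L}
    [DirectSum.Decomposition 𝓛] {S : LieSuperalgebra 𝓛} {m n : ℕ} (P : GradedMatrixRep S m n)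
    (J : S.U →ₐ[ℂ] PBF) : Prop :=
  (∀ X ∈ 𝓛 0, J (S.ι X) =
    (1 / 2 : ℂ) • ∑ k : Fin m, ∑ l : Fin m, P.A X k l • antiComm (PBF.B k 1) (PBF.B l (-1)) +
    (1 / 2 : ℂ) • ∑ α : Fin n, ∑ β : Fin n, P.D X α β • ringComm (PBF.F α 1) (PBF.F β (-1))) ∧
  (∀ Y ∈ 𝓛 1, J (S.ι Y) =
    (1 / 2 : ℂ) • ∑ k : Fin m, ∑ α : Fin n,
      (P.B Y k α • antiComm (PBF.B k 1) (PBF.F α (-1)) +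
        P.C Y α k • antiComm (PBF.F α 1) (PBF.B k (-1))))

/-!
Everything rests on coloured brackets `⟨x, y⟩ = xy - θ(deg x, deg y) yx` for a commutation factor
`θ`. All the defining relations of the relative parabose set read `⟨⟨x, y⟩, z⟩ = (a combination of
generators)`, and those of `U(L)` read `⟨x, y⟩ = [x, y]`.

*Hopf structures.* Left multiplication by `x ⊗ 1 + 1 ⊗ x` on the braided tensor square, for `x` of
degree `a`, is the operator `primMul θ 𝒜 a x = (x ·) ⊗ 1 + τ_a ⊗ (x ·)`, where the twist `τ_a`
multiplies degree `b` by `θ(a, b)`. It turns coloured brackets into coloured brackets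
(`primMul_bracket`), and so does `antiMul θ 𝒜 a x = -(· x) ∘ τ_a` on the algebra itself
(`antiMul_bracket`). Hence the relations of either algebra hold for these operators, which gives
representations `ρ` and `σ`; the comultiplication is `y ↦ ρ(y)(1 ⊗ 1)` and the antipode is
`y ↦ σ(y)(1)`. These maps satisfy the recursions `Δ(xy) = primMul x (Δ y)` and
`S(xy) = antiMul x (S y)` in primitive generators `x`, from which all the axioms follow by
induction on words (`BraidedHopf.ofGenerators`). Conversely every braided Hopf structure satisfies
the recursions, which gives uniqueness (`BraidedHopf.eq_of_primitive`), and the compatibility of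
graded algebra maps that send primitive generators to primitive elements
(`preservesHopf_of_primitive`).

*The realization.* Half the coloured brackets of creation and annihilation operators are matrix
units of `gl(m|n)` (`PBF.matUnit_bracket_matUnit`): they act on the creation operators by the
standard representation and on the annihilation operators by its dual, and a coloured bracket acts
on a coloured bracket by derivations. The map `J` sends `x ∈ L` to the combination of matrix units
with coefficients `P(x)`.

*The subalgebra `W`.* Coloured brackets of primitive elements are primitive, so `W` is generated by
primitive elements; hence `Δ` maps it to `W ⊗ W`, which embeds in the full tensor square, and `S`
maps it to itself (`PBF.exists_hopf_W`). The images of elements of `L` lie among these primitive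
generators.
-/

/-! ### Commutation factors and the twist operators -/

/-- A commutation factor on `G`: a bicharacter with `θ(a, b) θ(b, a) = 1`. -/
structure IsCommutationFactor {G : Type*} [AddCommGroup G] (θ : G → G → ℂ) : Prop where
  add_left : ∀ a b c, θ (a + b) c = θ a c * θ b c
  add_right : ∀ a b c, θ a (b + c) = θ a b * θ a c
  mul_swap : ∀ a b, θ a b * θ b a = 1

namespace IsCommutationFactor

variable {G : Type*} [AddCommGroup G] {θ : G → G → ℂ}

theorem ne_zero (hθ : IsCommutationFactor θ) (a b : G) : θ a b ≠ 0 := fun h => by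
  simpa [h] using hθ.mul_swap a b

theorem zero_left (hθ : IsCommutationFactor θ) (a : G) : θ 0 a = 1 := by
  have h := hθ.add_left 0 0 a
  rw [add_zero] at h
  exact (mul_eq_left₀ (hθ.ne_zero 0 a)).1 h.symm

theorem zero_right (hθ : IsCommutationFactor θ) (a : G) : θ a 0 = 1 := by
  have h := hθ.add_right a 0 0
  rw [add_zero] at h
  exact (mul_eq_left₀ (hθ.ne_zero a 0)).1 h.symm

end IsCommutationFactor

section Twist

variable {G : Type*} [AddCommGroup G] [DecidableEq G] (θ : G → G → ℂ) {A : Type*} [Ring A] [Algebra ℂ A] (𝒜 : G → Submodule ℂ A) [GradedAlgebra 𝒜]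

theorem proj_of_mem {a : G} {x : A} (hx : x ∈ 𝒜 a) : GradedAlgebra.proj 𝒜 a x = x :=
  DirectSum.decompose_of_mem_same 𝒜 hx

theorem proj_of_mem_ne {a b : G} {x : A} (hx : x ∈ 𝒜 a) (h : a ≠ b) :
    GradedAlgebra.proj 𝒜 b x = 0 :=
  DirectSum.decompose_of_mem_ne 𝒜 hx h

/-- The tensor square is spanned by the pure tensors whose right factor is homogeneous. -/
theorem tensor_induction_right {p : A ⊗[ℂ] A → Prop} (zero : p 0)
    (add : ∀ s t, p s → p t → p (s + t)) (tmul : ∀ u b, ∀ v ∈ 𝒜 b, p (u ⊗ₜ v)) (t : A ⊗[ℂ] A) :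
    p t := by
  induction t using TensorProduct.induction_on with
  | zero => exact zero
  | add s t hs ht => exact add s t hs ht
  | tmul u v =>
    induction v using DirectSum.Decomposition.inductionOn 𝒜 with
    | zero => rw [TensorProduct.tmul_zero]; exact zero
    | add m m' hm hm' => rw [TensorProduct.tmul_add]; exact add _ _ hm hm'
    | homogeneous m => exact tmul u _ m m.2

variable [Fintype G]

/-- The action of the degree `a` on a graded algebra through `θ`: it multiplies the elements of
degree `b` by `θ(a, b)`. -/
noncomputable def twist (a : G) : A →ₗ[ℂ] A := ∑ b, θ a b • GradedAlgebra.proj 𝒜 b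

variable {θ}

theorem twist_of_mem (a : G) {b : G} {x : A} (hx : x ∈ 𝒜 b) : twist θ 𝒜 a x = θ a b • x := by
  rw [twist, LinearMap.sum_apply, Finset.sum_eq_single b]
  · rw [LinearMap.smul_apply, proj_of_mem 𝒜 hx]
  · intro c _ hc
    rw [LinearMap.smul_apply, proj_of_mem_ne 𝒜 hx hc.symm, smul_zero]
  · simp

theorem twist_mem (a : G) {b : G} {x : A} (hx : x ∈ 𝒜 b) : twist θ 𝒜 a x ∈ 𝒜 b := by
  rw [twist_of_mem 𝒜 a hx]
  exact (𝒜 b).smul_mem _ hx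

theorem twist_one (hθ : IsCommutationFactor θ) (a : G) : twist θ 𝒜 a 1 = 1 := by
  rw [twist_of_mem 𝒜 a SetLike.GradedOne.one_mem, hθ.zero_right, one_smul]

theorem twist_mul (hθ : IsCommutationFactor θ) (a : G) (x y : A) :
    twist θ 𝒜 a (x * y) = twist θ 𝒜 a x * twist θ 𝒜 a y := by
  induction x using DirectSum.Decomposition.inductionOn 𝒜 with
  | zero => simp
  | add m m' hm hm' => rw [add_mul, map_add, map_add, add_mul, hm, hm']
  | homogeneous m =>
    induction y using DirectSum.Decomposition.inductionOn 𝒜 with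
    | zero => simp
    | add n n' hn hn' => rw [mul_add, map_add, map_add, mul_add, hn, hn']
    | homogeneous n =>
      rw [twist_of_mem 𝒜 a m.2, twist_of_mem 𝒜 a n.2,
        twist_of_mem 𝒜 a (SetLike.mul_mem_graded m.2 n.2), hθ.add_right, smul_mul_smul_comm]

theorem twist_twist (hθ : IsCommutationFactor θ) (a b : G) (x : A) :
    twist θ 𝒜 a (twist θ 𝒜 b x) = twist θ 𝒜 (a + b) x := by
  induction x using DirectSum.Decomposition.inductionOn 𝒜 with
  | zero => simp
  | add m m' hm hm' => simp only [map_add, hm, hm']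
  | homogeneous m =>
    rw [twist_of_mem 𝒜 b m.2, map_smul, twist_of_mem 𝒜 a m.2, twist_of_mem 𝒜 _ m.2, smul_smul,
      hθ.add_left, mul_comm]

theorem twist_zero (hθ : IsCommutationFactor θ) (x : A) : twist θ 𝒜 0 x = x := by
  induction x using DirectSum.Decomposition.inductionOn 𝒜 with
  | zero => simp
  | add m m' hm hm' => rw [map_add, hm, hm']
  | homogeneous m => rw [twist_of_mem 𝒜 0 m.2, hθ.zero_left, one_smul]

/-- A linear map that preserves degrees commutes with the twists. -/
theorem twist_comm_of_map_mem {f : A →ₗ[ℂ] A} (hf : ∀ a, ∀ x ∈ 𝒜 a, f x ∈ 𝒜 a) (a : G) (x : A) :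
    f (twist θ 𝒜 a x) = twist θ 𝒜 a (f x) := by
  induction x using DirectSum.Decomposition.inductionOn 𝒜 with
  | zero => simp
  | add m m' hm hm' => simp only [map_add, hm, hm']
  | homogeneous m =>
    rw [twist_of_mem 𝒜 a m.2, map_smul, twist_of_mem 𝒜 a (hf _ _ m.2)]

variable {𝒜} in
/-- A map concentrated in degree `0`, such as a counit, is invariant under the twists. -/
theorem map_twist_of_vanishing (hθ : IsCommutationFactor θ) {M : Type*} [AddCommGroup M]
    [Module ℂ M] {f : A →ₗ[ℂ] M} (hf : ∀ a, a ≠ 0 → ∀ x ∈ 𝒜 a, f x = 0) (a : G) (x : A) :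
    f (twist θ 𝒜 a x) = f x := by
  induction x using DirectSum.Decomposition.inductionOn 𝒜 with
  | zero => simp
  | add m m' hm hm' => simp only [map_add, hm, hm']
  | @homogeneous b m =>
    rw [twist_of_mem 𝒜 a m.2, map_smul]
    by_cases hb : b = 0
    · subst hb
      rw [hθ.zero_right, one_smul]
    · rw [hf b hb _ m.2, smul_zero]

/-! ### The operators of the braided tensor square -/

variable (θ)

/-- Left multiplication by `x ⊗ 1 + 1 ⊗ x` on the braided tensor square, for `x` of degree `a`. -/
noncomputable def primMul (a : G) : A →ₗ[ℂ] Module.End ℂ (A ⊗[ℂ] A) where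
  toFun x := TensorProduct.map (LinearMap.mulLeft ℂ x) LinearMap.id +
    TensorProduct.map (twist θ 𝒜 a) (LinearMap.mulLeft ℂ x)
  map_add' x y := by
    ext z w
    simp only [TensorProduct.AlgebraTensorModule.curry_apply, TensorProduct.curry_apply,
      LinearMap.restrictScalars_self, LinearMap.add_apply, TensorProduct.map_tmul,
      LinearMap.mulLeft_apply, LinearMap.id_apply, add_mul, TensorProduct.add_tmul,
      TensorProduct.tmul_add]
    abel
  map_smul' c x := by
    ext z w
    simp [TensorProduct.smul_tmul']

/-- The operator `z ↦ -θ(a, deg z) zx`, for `x` of degree `a`: the effect on antipodes of left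
multiplication by a primitive element. -/
noncomputable def antiMul (a : G) : A →ₗ[ℂ] Module.End ℂ A where
  toFun x := -(LinearMap.mulRight ℂ x ∘ₗ twist θ 𝒜 a)
  map_add' x y := by
    ext z
    simp only [LinearMap.neg_apply, LinearMap.comp_apply, LinearMap.mulRight_apply, mul_add,
      LinearMap.add_apply]
    abel
  map_smul' c x := by
    ext z
    simp

variable {θ}

@[simp] theorem primMul_tmul (a : G) (x z w : A) :
    primMul θ 𝒜 a x (z ⊗ₜ w) = (x * z) ⊗ₜ w + twist θ 𝒜 a z ⊗ₜ (x * w) := rfl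

@[simp] theorem antiMul_apply (a : G) (x z : A) :
    antiMul θ 𝒜 a x z = -(twist θ 𝒜 a z * x) := rfl

/-- In the braided tensor square `x ⊗ 1` and `1 ⊗ y` commute up to `θ`, so the mixed terms of the
coloured bracket of `x ⊗ 1 + 1 ⊗ x` and `y ⊗ 1 + 1 ⊗ y` cancel: primitive elements are closed
under the coloured bracket. -/
theorem primMul_bracket (hθ : IsCommutationFactor θ) {a b : G} {x y : A} (hx : x ∈ 𝒜 a)
    (hy : y ∈ 𝒜 b) :
    primMul θ 𝒜 a x * primMul θ 𝒜 b y - θ a b • (primMul θ 𝒜 b y * primMul θ 𝒜 a x) =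
      primMul θ 𝒜 (a + b) (x * y - θ a b • (y * x)) := by
  apply TensorProduct.ext'
  intro z w
  simp only [LinearMap.sub_apply, Module.End.mul_apply, LinearMap.smul_apply, primMul_tmul,
    map_add, twist_mul 𝒜 hθ, twist_of_mem 𝒜 a hy, twist_of_mem 𝒜 b hx, twist_twist 𝒜 hθ,
    sub_mul, TensorProduct.sub_tmul, TensorProduct.tmul_sub, smul_add, add_comm b a,
    smul_mul_assoc, TensorProduct.smul_tmul', TensorProduct.tmul_smul, smul_smul, mul_assoc,
    hθ.mul_swap, one_smul]
  abel

theorem antiMul_bracket (hθ : IsCommutationFactor θ) {a b : G} {x y : A} (hx : x ∈ 𝒜 a)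
    (hy : y ∈ 𝒜 b) :
    antiMul θ 𝒜 a x * antiMul θ 𝒜 b y - θ a b • (antiMul θ 𝒜 b y * antiMul θ 𝒜 a x) =
      antiMul θ 𝒜 (a + b) (x * y - θ a b • (y * x)) := by
  ext z
  simp only [LinearMap.sub_apply, Module.End.mul_apply, LinearMap.smul_apply, antiMul_apply,
    map_neg, neg_neg, twist_mul 𝒜 hθ, twist_of_mem 𝒜 a hy, twist_of_mem 𝒜 b hx,
    twist_twist 𝒜 hθ, mul_sub, add_comm b a, smul_mul_assoc, mul_smul_comm, smul_smul, mul_assoc,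
    hθ.mul_swap, one_smul]
  abel

theorem primMul_mem_tensorGrade {a b : G} {x : A} (hx : x ∈ 𝒜 a) {t : A ⊗[ℂ] A}
    (ht : t ∈ tensorGrade 𝒜 b) : primMul θ 𝒜 a x t ∈ tensorGrade 𝒜 (a + b) := by
  refine (Submodule.span_le (p := (tensorGrade 𝒜 (a + b)).comap (primMul θ 𝒜 a x))).2 ?_ ht
  rintro _ ⟨c, d, rfl, u, hu, v, hv, rfl⟩
  refine Submodule.add_mem _ (Submodule.subset_span ?_) (Submodule.subset_span ?_)
  · exact ⟨a + c, d, add_assoc _ _ _, _, SetLike.mul_mem_graded hx hu, _, hv, rfl⟩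
  · exact ⟨c, a + d, add_left_comm _ _ _, _, twist_mem 𝒜 a hu, _, SetLike.mul_mem_graded hx hv, rfl⟩

theorem map_twist_of_mem_tensorGrade (hθ : IsCommutationFactor θ) (a : G) {b : G} {t : A ⊗[ℂ] A}
    (ht : t ∈ tensorGrade 𝒜 b) :
    TensorProduct.map (twist θ 𝒜 a) (twist θ 𝒜 a) t = θ a b • t := by
  refine LinearMap.eqOn_span (f := TensorProduct.map (twist θ 𝒜 a) (twist θ 𝒜 a))
    (g := θ a b • LinearMap.id) ?_ ht
  rintro _ ⟨c, d, rfl, u, hu, v, hv, rfl⟩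
  rw [TensorProduct.map_tmul, twist_of_mem 𝒜 a hu, twist_of_mem 𝒜 a hv, TensorProduct.smul_tmul_smul,
    ← hθ.add_right]
  rfl

/-! ### The braided multiplication -/

theorem braidedMul_add_left (s s' t : A ⊗[ℂ] A) :
    braidedMul θ 𝒜 (s + s') t = braidedMul θ 𝒜 s t + braidedMul θ 𝒜 s' t := by
  simp only [braidedMul, map_add, add_mul, smul_add, Finset.sum_add_distrib]

theorem braidedMul_add_right (s t t' : A ⊗[ℂ] A) :
    braidedMul θ 𝒜 s (t + t') = braidedMul θ 𝒜 s t + braidedMul θ 𝒜 s t' := by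
  simp only [braidedMul, map_add, mul_add, smul_add, Finset.sum_add_distrib]

theorem braidedMul_zero_left (t : A ⊗[ℂ] A) : braidedMul θ 𝒜 0 t = 0 := by simp [braidedMul]

theorem braidedMul_zero_right (s : A ⊗[ℂ] A) : braidedMul θ 𝒜 s 0 = 0 := by simp [braidedMul]

theorem braidedMul_tmul {b : G} (u : A) {v : A} (hv : v ∈ 𝒜 b) (t : A ⊗[ℂ] A) :
    braidedMul θ 𝒜 (u ⊗ₜ v) t =
      TensorProduct.map (LinearMap.mulLeft ℂ u ∘ₗ twist θ 𝒜 b) (LinearMap.mulLeft ℂ v) t := by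
  induction t using TensorProduct.induction_on with
  | zero => rw [braidedMul_zero_right, map_zero]
  | add t t' ht ht' => rw [braidedMul_add_right, map_add, ht, ht']
  | tmul z w =>
    rw [braidedMul, Finset.sum_eq_single b]
    · simp only [TensorProduct.map_tmul, LinearMap.id_apply, proj_of_mem 𝒜 hv,
        Algebra.TensorProduct.tmul_mul_tmul, LinearMap.comp_apply, LinearMap.mulLeft_apply, twist,
        LinearMap.sum_apply, LinearMap.smul_apply, Finset.mul_sum, TensorProduct.sum_tmul,
        mul_smul_comm, TensorProduct.smul_tmul']
    · intro c _ hc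
      simp only [TensorProduct.map_tmul, proj_of_mem_ne 𝒜 hv hc.symm, TensorProduct.tmul_zero,
        zero_mul, smul_zero, Finset.sum_const_zero]
    · simp

theorem one_braidedMul (hθ : IsCommutationFactor θ) (t : A ⊗[ℂ] A) :
    braidedMul θ 𝒜 (1 ⊗ₜ 1) t = t := by
  rw [braidedMul_tmul 𝒜 1 SetLike.GradedOne.one_mem]
  conv_rhs => rw [← LinearMap.id_apply (R := ℂ) t, ← TensorProduct.map_id]
  congr 2
  · ext x; simp [twist_zero 𝒜 hθ]
  · ext x; simp

/-- The operator `primMul θ 𝒜 a x` agrees with `braidedMul` by `1 ⊗ x + x ⊗ 1`, the value of a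
comultiplication at a primitive element. -/
theorem primitive_braidedMul (hθ : IsCommutationFactor θ) {a : G} {x : A} (hx : x ∈ 𝒜 a)
    (t : A ⊗[ℂ] A) :
    braidedMul θ 𝒜 (1 ⊗ₜ x + x ⊗ₜ 1) t = primMul θ 𝒜 a x t := by
  rw [braidedMul_add_left, braidedMul_tmul 𝒜 _ hx, braidedMul_tmul 𝒜 _ SetLike.GradedOne.one_mem,
    add_comm]
  change _ = TensorProduct.map (LinearMap.mulLeft ℂ x) LinearMap.id t +
    TensorProduct.map (twist θ 𝒜 a) (LinearMap.mulLeft ℂ x) t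
  congr 3
  · ext y; simp [twist_zero 𝒜 hθ]
  · ext y; simp
  · ext y; simp

/-- The instance of associativity of the braided multiplication that inductions on words need. -/
theorem primMul_braidedMul (hθ : IsCommutationFactor θ) {a : G} {x : A} (hx : x ∈ 𝒜 a)
    (s t : A ⊗[ℂ] A) :
    primMul θ 𝒜 a x (braidedMul θ 𝒜 s t) = braidedMul θ 𝒜 (primMul θ 𝒜 a x s) t := by
  induction s using tensor_induction_right 𝒜 with
  | zero => simp only [map_zero, braidedMul_zero_left]
  | add s s' hs hs' => simp only [map_add, braidedMul_add_left, hs, hs']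
  | tmul u b v hv =>
    rw [primMul_tmul, braidedMul_add_left, braidedMul_tmul 𝒜 _ hv, braidedMul_tmul 𝒜 _ hv,
      braidedMul_tmul 𝒜 _ (SetLike.mul_mem_graded hx hv)]
    induction t using TensorProduct.induction_on with
    | zero => simp only [map_zero, add_zero]
    | add t t' ht ht' => simp only [map_add, ht, ht']; abel
    | tmul z w => simp [twist_mul 𝒜 hθ, twist_twist 𝒜 hθ]

end Twist

/-! ### Braided Hopf structures with primitive generators -/

/-- The homogeneous elements `gen` generate the graded algebra: each homogeneous component
is spanned by the words of its degree. -/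
structure GeneratesGraded {G A : Type*} [AddCommGroup G] [Ring A] [Algebra ℂ A]
    (gen : G → Set A) (𝒜 : G → Submodule ℂ A) : Prop where
  mem : ∀ a, ∀ x ∈ gen a, x ∈ 𝒜 a
  le_wordSpan : ∀ a, 𝒜 a ≤ wordSpan gen a

section Generators

variable {G : Type*} [AddCommGroup G] {A : Type*} [Ring A] [Algebra ℂ A]
  {𝒜 : G → Submodule ℂ A} {gen : G → Set A}

theorem wordSpan_le {N : G → Submodule ℂ A} (one : 1 ∈ N 0)
    (mul : ∀ a b, ∀ x ∈ gen a, ∀ y ∈ N b, x * y ∈ N (a + b)) (b : G) : wordSpan gen b ≤ N b := by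
  refine Submodule.span_le.2 fun x hx => ?_
  induction hx with
  | one => exact one
  | mul hx _ ih => exact mul _ _ _ hx _ ih

theorem generatesGraded_wordSpan (gen : G → Set A) : GeneratesGraded gen (wordSpan gen) :=
  ⟨fun _ _ hx => mem_wordSpan_of_gen hx, fun _ => le_rfl⟩

theorem GeneratesGraded.grade_le (h : GeneratesGraded gen 𝒜) {N : G → Submodule ℂ A}
    (one : 1 ∈ N 0) (mul : ∀ a b, ∀ x ∈ gen a, ∀ y ∈ N b, x * y ∈ N (a + b)) (b : G) :
    𝒜 b ≤ N b :=
  (h.le_wordSpan b).trans (wordSpan_le one mul b)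

variable [DecidableEq G] [GradedAlgebra 𝒜]

theorem GeneratesGraded.mem_submodule (h : GeneratesGraded gen 𝒜) {N : Submodule ℂ A}
    (one : 1 ∈ N) (mul : ∀ a, ∀ x ∈ gen a, ∀ y ∈ N, x * y ∈ N) (x : A) : x ∈ N := by
  induction x using DirectSum.Decomposition.inductionOn 𝒜 with
  | zero => exact N.zero_mem
  | add x y hx hy => exact N.add_mem hx hy
  | homogeneous x =>
    exact h.grade_le (N := fun _ => N) one (fun a _ x hx y hy => mul a x hx y hy) _ x.2

/-- Homogeneous elements that generate the algebra span each component by words. -/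
theorem GeneratesGraded.of_adjoin_eq_top (mem : ∀ a, ∀ x ∈ gen a, x ∈ 𝒜 a)
    (hgen : Algebra.adjoin ℂ (⋃ a, gen a) = ⊤) : GeneratesGraded gen 𝒜 := by
  refine ⟨mem, fun a x hx => ?_⟩
  have hword : ∀ b, ∀ y, HomogWord gen b y → y ∈ 𝒜 b := fun b y hy =>
    wordSpan_le (N := 𝒜) SetLike.GradedOne.one_mem
      (fun a b x hx y hy => SetLike.mul_mem_graded (mem a x hx) hy) b (Submodule.subset_span hy)
  have hle : (⊤ : Submodule ℂ A) ≤ (wordSpan gen a).comap (GradedAlgebra.proj 𝒜 a) := by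
    rw [← Algebra.top_toSubmodule, ← hgen, Algebra.adjoin_eq_span, Submodule.span_le]
    intro y hy
    obtain ⟨b, hb⟩ : ∃ b, HomogWord gen b y := by
      induction hy using Submonoid.closure_induction_left with
      | one => exact ⟨0, .one⟩
      | mul_left x hx y _ ih =>
        obtain ⟨a, ha⟩ := Set.mem_iUnion.1 hx
        obtain ⟨b, hb⟩ := ih
        exact ⟨a + b, .mul ha hb⟩
    change GradedAlgebra.proj 𝒜 a y ∈ wordSpan gen a
    by_cases hab : b = a
    · subst hab
      rw [proj_of_mem 𝒜 (hword _ _ hb)]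
      exact Submodule.subset_span hb
    · rw [proj_of_mem_ne 𝒜 (hword _ _ hb) hab]
      exact Submodule.zero_mem _
  have h := hle (Submodule.mem_top (x := x))
  rwa [Submodule.mem_comap, proj_of_mem 𝒜 hx] at h

theorem GeneratesGraded.linearMap_ext (h : GeneratesGraded gen 𝒜) {M : Type*} [AddCommGroup M]
    [Module ℂ M] {f g : A →ₗ[ℂ] M} (one : f 1 = g 1)
    (mul : ∀ a, ∀ x ∈ gen a, ∀ y, f y = g y → f (x * y) = g (x * y)) : f = g :=
  LinearMap.ext fun x => h.mem_submodule (N := LinearMap.eqLocus f g) one mul x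

theorem GeneratesGraded.algHom_ext (h : GeneratesGraded gen 𝒜) {B : Type*} [Ring B]
    [Algebra ℂ B] {f g : A →ₐ[ℂ] B} (hfg : ∀ a, ∀ x ∈ gen a, f x = g x) : f = g :=
  AlgHom.toLinearMap_injective <| h.linearMap_ext (by simp) fun a x hx y hy => by
    simp only [AlgHom.toLinearMap_apply, map_mul] at hy ⊢
    rw [hy, hfg a x hx]

variable [Fintype G] {θ : G → G → ℂ}

/-- A comultiplication and an antipode that satisfy the recursions of primitive generators
on words define, together with the counit that kills the generators, a braided Hopf structure. -/
noncomputable def BraidedHopf.ofGenerators (hθ : IsCommutationFactor θ)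
    (h : GeneratesGraded gen 𝒜) (Δ : A →ₗ[ℂ] A ⊗[ℂ] A) (ε : A →ₐ[ℂ] ℂ) (S : A →ₗ[ℂ] A)
    (Δ_one : Δ 1 = 1 ⊗ₜ 1)
    (Δ_mul : ∀ a, ∀ x ∈ gen a, ∀ y, Δ (x * y) = primMul θ 𝒜 a x (Δ y))
    (ε_gen : ∀ a, ∀ x ∈ gen a, ε x = 0) (S_one : S 1 = 1)
    (S_mul : ∀ a, ∀ x ∈ gen a, ∀ y, S (x * y) = antiMul θ 𝒜 a x (S y)) : BraidedHopf θ 𝒜 := by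
  have hΔ : ∀ a, ∀ x ∈ 𝒜 a, Δ x ∈ tensorGrade 𝒜 a := fun a =>
    h.grade_le (N := fun a => (tensorGrade 𝒜 a).comap Δ)
      (by
        rw [Submodule.mem_comap, Δ_one]
        exact Submodule.subset_span
          ⟨0, 0, add_zero 0, 1, SetLike.GradedOne.one_mem, 1, SetLike.GradedOne.one_mem, rfl⟩)
      (fun a b x hx y hy => by
        rw [Submodule.mem_comap, Δ_mul a x hx]
        exact primMul_mem_tensorGrade 𝒜 (h.mem a x hx) hy) a
  have hS : ∀ a, ∀ x ∈ 𝒜 a, S x ∈ 𝒜 a := fun a =>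
    h.grade_le (N := fun a => (𝒜 a).comap S)
      (by rw [Submodule.mem_comap, S_one]; exact SetLike.GradedOne.one_mem)
      (fun a b x hx y hy => by
        rw [Submodule.mem_comap, S_mul a x hx, antiMul_apply, add_comm]
        exact Submodule.neg_mem _ (SetLike.mul_mem_graded (twist_mem 𝒜 a hy) (h.mem a x hx))) a
  have hε : ∀ a, a ≠ 0 → ∀ x ∈ 𝒜 a, ε x = 0 := fun a ha x hx => by
    -- a word of nonzero degree contains a generator
    have h0 := h.grade_le (N := fun a => ⨅ _ : a ≠ 0, LinearMap.ker ε.toLinearMap) (by simp)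
      (fun a b x hx y _ => by simp [Submodule.mem_iInf, ε_gen a x hx]) a hx
    simpa [Submodule.mem_iInf, ha] using h0
  have hS_mul : ∀ a, ∀ x ∈ 𝒜 a, ∀ y, S (x * y) = twist θ 𝒜 a (S y) * S x := fun a x hx => by
    have := h.grade_le (N := fun a =>
      { carrier := {x | ∀ y, S (x * y) = twist θ 𝒜 a (S y) * S x}
        add_mem' := fun {u v} hu hv y => by rw [add_mul, map_add, hu y, hv y, map_add, mul_add]
        zero_mem' := fun y => by simp
        smul_mem' := fun c u hu y => by
          rw [smul_mul_assoc, map_smul, hu y, map_smul, mul_smul_comm] })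
      (fun y => by rw [one_mul, S_one, mul_one, twist_zero 𝒜 hθ])
      (fun a b x hx y hy z => by
        rw [mul_assoc, S_mul a x hx, hy z, S_mul a x hx, antiMul_apply, antiMul_apply,
          twist_mul 𝒜 hθ, twist_twist 𝒜 hθ, mul_neg, mul_assoc]) a hx
    exact this
  have hΔ_mul : ∀ x y, Δ (x * y) = braidedMul θ 𝒜 (Δ x) (Δ y) := fun x y => by
    have : Δ ∘ₗ LinearMap.mulRight ℂ y =
        { toFun := fun x => braidedMul θ 𝒜 (Δ x) (Δ y)
          map_add' := fun u v => by rw [map_add, braidedMul_add_left]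
          map_smul' := fun c u => by
            simp [braidedMul, Finset.smul_sum, smul_comm c] } := by
      refine h.linearMap_ext ?_ ?_
      · change Δ (1 * y) = braidedMul θ 𝒜 (Δ 1) (Δ y)
        rw [one_mul, Δ_one, one_braidedMul 𝒜 hθ]
      · intro a u hu v hv
        change Δ (v * y) = braidedMul θ 𝒜 (Δ v) (Δ y) at hv
        change Δ (u * v * y) = braidedMul θ 𝒜 (Δ (u * v)) (Δ y)
        rw [mul_assoc, Δ_mul a u hu, hv, Δ_mul a u hu, primMul_braidedMul 𝒜 hθ (h.mem a u hu)]
    exact LinearMap.congr_fun this x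
  exact
  { comul := Δ
    counit := ε
    antipode := S
    comul_mem := hΔ
    counit_eq_zero := hε
    antipode_mem := hS
    comul_one := Δ_one
    comul_mul := hΔ_mul
    coassoc := by
      refine h.linearMap_ext ?_ ?_
      · simp [Δ_one]
      · intro a x hx y hy
        have hcomm : ∀ z, Δ (twist θ 𝒜 a z) =
            TensorProduct.map (twist θ 𝒜 a) (twist θ 𝒜 a) (Δ z) := fun z => by
          induction z using DirectSum.Decomposition.inductionOn 𝒜 with
          | zero => simp
          | add m m' hm hm' => simp only [map_add, hm, hm']
          | homogeneous m =>
            rw [twist_of_mem 𝒜 a m.2, map_smul, map_twist_of_mem_tensorGrade 𝒜 hθ a (hΔ _ _ m.2)]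
        -- both iterates turn left multiplication by `x` into the same operator
        -- `x ⊗ 1 ⊗ 1 + 1 ⊗ x ⊗ 1 + 1 ⊗ 1 ⊗ x` of the braided tensor cube
        let T : Module.End ℂ (A ⊗[ℂ] (A ⊗[ℂ] A)) :=
          TensorProduct.map (LinearMap.mulLeft ℂ x) LinearMap.id +
            TensorProduct.map (twist θ 𝒜 a) (primMul θ 𝒜 a x)
        have hr : ∀ t, Δ.lTensor A (primMul θ 𝒜 a x t) = T (Δ.lTensor A t) := fun t => by
          induction t using TensorProduct.induction_on with
          | zero => simp
          | add s t hs ht => simp only [map_add, hs, ht]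
          | tmul z w => simp [T, Δ_mul a x hx]
        have hl : ∀ t, TensorProduct.assoc ℂ A A A (Δ.rTensor A (primMul θ 𝒜 a x t)) =
            T (TensorProduct.assoc ℂ A A A (Δ.rTensor A t)) := fun t => by
          induction t using TensorProduct.induction_on with
          | zero => simp
          | add s t hs ht => simp only [map_add, hs, ht]
          | tmul z w =>
            simp only [primMul_tmul, map_add, LinearMap.rTensor_tmul, Δ_mul a x hx, hcomm]
            induction Δ z using TensorProduct.induction_on with
            | zero => simp
            | add s t hs ht =>
              simp only [map_add, TensorProduct.add_tmul] at hs ht ⊢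
              rw [← hs, ← ht]
              abel
            | tmul p q =>
              simp [T, TensorProduct.add_tmul, TensorProduct.tmul_add, add_assoc]
        simp only [LinearMap.comp_apply, LinearEquiv.coe_coe] at hy ⊢
        rw [Δ_mul a x hx, hl, hy, hr]
    counit_comul := by
      have : ε.toLinearMap.rTensor A ∘ₗ Δ = TensorProduct.mk ℂ ℂ A 1 := by
        refine h.linearMap_ext ?_ ?_
        · simp [Δ_one]
        · intro a x hx y hy
          have key : ∀ t, ε.toLinearMap.rTensor A (primMul θ 𝒜 a x t) =
              (LinearMap.mulLeft ℂ x).lTensor ℂ (ε.toLinearMap.rTensor A t) := fun t => by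
            induction t using TensorProduct.induction_on with
            | zero => simp
            | add s t hs ht => simp only [map_add, hs, ht]
            | tmul z w =>
              have : ε (twist θ 𝒜 a z) = ε z :=
                map_twist_of_vanishing hθ (f := ε.toLinearMap) hε a z
              simp [ε_gen a x hx, this]
          simp only [LinearMap.comp_apply] at hy ⊢
          rw [Δ_mul a x hx, key, hy]
          simp
      exact fun x => LinearMap.congr_fun this x
    comul_counit := by
      have : ε.toLinearMap.lTensor A ∘ₗ Δ = (TensorProduct.mk ℂ A ℂ).flip 1 := by
        refine h.linearMap_ext ?_ ?_
        · simp [Δ_one]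
        · intro a x hx y hy
          have key : ∀ t, ε.toLinearMap.lTensor A (primMul θ 𝒜 a x t) =
              (LinearMap.mulLeft ℂ x).rTensor ℂ (ε.toLinearMap.lTensor A t) := fun t => by
            induction t using TensorProduct.induction_on with
            | zero => simp
            | add s t hs ht => simp only [map_add, hs, ht]
            | tmul z w => simp [ε_gen a x hx]
          simp only [LinearMap.comp_apply] at hy ⊢
          rw [Δ_mul a x hx, key, hy]
          simp
      exact fun x => LinearMap.congr_fun this x
    antipode_left := by
      have : LinearMap.mul' ℂ A ∘ₗ S.rTensor A ∘ₗ Δ =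
          Algebra.linearMap ℂ A ∘ₗ ε.toLinearMap := by
        refine h.linearMap_ext ?_ ?_
        · simp [Δ_one, S_one]
        · intro a x hx y _
          have key : ∀ t, LinearMap.mul' ℂ A (S.rTensor A (primMul θ 𝒜 a x t)) = 0 := fun t => by
            induction t using TensorProduct.induction_on with
            | zero => simp
            | add s t hs ht => simp only [map_add, hs, ht, add_zero]
            | tmul z w =>
              simp [S_mul a x hx, twist_comm_of_map_mem 𝒜 hS a z, mul_assoc]
          simp only [LinearMap.comp_apply]
          rw [Δ_mul a x hx, key]
          simp [ε_gen a x hx]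
      exact fun x => LinearMap.congr_fun this x
    antipode_right := by
      have : LinearMap.mul' ℂ A ∘ₗ S.lTensor A ∘ₗ Δ =
          Algebra.linearMap ℂ A ∘ₗ ε.toLinearMap := by
        refine h.linearMap_ext ?_ ?_
        · simp [Δ_one, S_one]
        · intro a x hx y hy
          have key : ∀ t, LinearMap.mul' ℂ A (S.lTensor A (primMul θ 𝒜 a x t)) =
              x * LinearMap.mul' ℂ A (S.lTensor A t) -
                twist θ 𝒜 a (LinearMap.mul' ℂ A (S.lTensor A t)) * x := fun t => by
            induction t using TensorProduct.induction_on with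
            | zero => simp
            | add s t hs ht => simp only [map_add, hs, ht, mul_add, add_mul]; abel
            | tmul z w =>
              simp [S_mul a x hx, twist_mul 𝒜 hθ, mul_assoc, sub_eq_add_neg]
          simp only [LinearMap.comp_apply] at hy ⊢
          -- the two terms cancel because the value at `y` is a scalar, which commutes with `x`
          rw [Δ_mul a x hx, key, hy]
          simp [ε_gen a x hx, Algebra.algebraMap_eq_smul_one, twist_one 𝒜 hθ]
      exact fun x => LinearMap.congr_fun this x
    antipode_mul := fun a b x hx y hy => by
      rw [hS_mul a x hx, twist_of_mem 𝒜 a (hS b y hy), smul_mul_assoc] }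

namespace BraidedHopf

theorem antipode_one (H : BraidedHopf θ 𝒜) : H.antipode 1 = 1 := by
  simpa [H.comul_one] using H.antipode_left 1

theorem comul_primitive_mul (hθ : IsCommutationFactor θ) (H : BraidedHopf θ 𝒜) {a : G} {x : A}
    (hx : x ∈ 𝒜 a) (hp : H.PrimitiveAt x) (y : A) :
    H.comul (x * y) = primMul θ 𝒜 a x (H.comul y) := by
  rw [H.comul_mul, hp.1, primitive_braidedMul 𝒜 hθ hx]

theorem antipode_mul_eq_twist (H : BraidedHopf θ 𝒜) {a : G} {x : A} (hx : x ∈ 𝒜 a) (y : A) :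
    H.antipode (x * y) = twist θ 𝒜 a (H.antipode y) * H.antipode x := by
  induction y using DirectSum.Decomposition.inductionOn 𝒜 with
  | zero => simp
  | add m m' hm hm' => rw [mul_add, map_add, hm, hm', map_add, map_add, add_mul]
  | homogeneous m =>
    rw [H.antipode_mul _ _ x hx _ m.2, twist_of_mem 𝒜 a (H.antipode_mem _ _ m.2), smul_mul_assoc]

theorem antipode_primitive_mul (H : BraidedHopf θ 𝒜) {a : G} {x : A}
    (hx : x ∈ 𝒜 a) (hp : H.PrimitiveAt x) (y : A) :
    H.antipode (x * y) = antiMul θ 𝒜 a x (H.antipode y) := by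
  rw [H.antipode_mul_eq_twist hx, hp.2.2, mul_neg, antiMul_apply]

theorem PrimitiveAt.add {H : BraidedHopf θ 𝒜} {x y : A} (hx : H.PrimitiveAt x)
    (hy : H.PrimitiveAt y) : H.PrimitiveAt (x + y) := by
  refine ⟨?_, by rw [map_add, hx.2.1, hy.2.1, add_zero], by rw [map_add, hx.2.2, hy.2.2, neg_add]⟩
  rw [map_add, hx.1, hy.1, TensorProduct.tmul_add, TensorProduct.add_tmul]
  abel

theorem PrimitiveAt.smul {H : BraidedHopf θ 𝒜} (c : ℂ) {x : A} (hx : H.PrimitiveAt x) :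
    H.PrimitiveAt (c • x) := by
  refine ⟨?_, by rw [map_smul, hx.2.1, smul_zero], by rw [map_smul, hx.2.2, smul_neg]⟩
  rw [map_smul, hx.1, smul_add, TensorProduct.tmul_smul, ← TensorProduct.smul_tmul' c x]

theorem PrimitiveAt.zero (H : BraidedHopf θ 𝒜) : H.PrimitiveAt (0 : A) := by
  simp [PrimitiveAt]

theorem PrimitiveAt.bracket (hθ : IsCommutationFactor θ) {H : BraidedHopf θ 𝒜} {a b : G} {x y : A}
    (hx : x ∈ 𝒜 a) (hy : y ∈ 𝒜 b) (px : H.PrimitiveAt x) (py : H.PrimitiveAt y) :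
    H.PrimitiveAt (x * y - θ a b • (y * x)) := by
  refine ⟨?_, by simp [px.2.1], ?_⟩
  · rw [map_sub, map_smul, H.comul_primitive_mul hθ hx px, H.comul_primitive_mul hθ hy py, px.1,
      py.1]
    simp only [map_add, primMul_tmul, twist_one 𝒜 hθ, mul_one, twist_of_mem 𝒜 a hy,
      twist_of_mem 𝒜 b hx, smul_add, TensorProduct.smul_tmul', smul_smul, hθ.mul_swap, one_smul,
      TensorProduct.tmul_sub, TensorProduct.sub_tmul, TensorProduct.tmul_smul]
    abel
  · rw [map_sub, map_smul, H.antipode_mul a b x hx y hy, H.antipode_mul b a y hy x hx, px.2.2,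
      py.2.2, neg_mul_neg, neg_mul_neg, smul_smul, hθ.mul_swap, one_smul, neg_sub]

/-- A braided Hopf structure is determined by the primitivity of its homogeneous generators. -/
theorem eq_of_primitive (hθ : IsCommutationFactor θ) (h : GeneratesGraded gen 𝒜)
    {H K : BraidedHopf θ 𝒜} (hH : ∀ a, ∀ x ∈ gen a, H.PrimitiveAt x)
    (hK : ∀ a, ∀ x ∈ gen a, K.PrimitiveAt x) : H = K := by
  have h1 : H.comul = K.comul := h.linearMap_ext (by rw [H.comul_one, K.comul_one])
    fun a x hx y hy => by
      rw [H.comul_primitive_mul hθ (h.mem a x hx) (hH a x hx),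
        K.comul_primitive_mul hθ (h.mem a x hx) (hK a x hx), hy]
  have h2 : H.counit = K.counit := h.algHom_ext fun a x hx => by
    rw [(hH a x hx).2.1, (hK a x hx).2.1]
  have h3 : H.antipode = K.antipode := h.linearMap_ext (by rw [H.antipode_one, K.antipode_one])
    fun a x hx y hy => by
      rw [H.antipode_primitive_mul (h.mem a x hx) (hH a x hx),
        K.antipode_primitive_mul (h.mem a x hx) (hK a x hx), hy]
  cases H
  cases K
  congr

/-- If the primitive generators of a graded algebra act on the tensor square by `primMul`, and on
the algebra itself by `antiMul`, through representations of the algebra, then the braided Hopf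
structure with these primitive elements exists. -/
theorem exists_of_representations (hθ : IsCommutationFactor θ) (h : GeneratesGraded gen 𝒜)
    (ρ : A →ₐ[ℂ] Module.End ℂ (A ⊗[ℂ] A)) (σ : A →ₐ[ℂ] Module.End ℂ A) (ε : A →ₐ[ℂ] ℂ)
    (hρ : ∀ a, ∀ x ∈ gen a, ρ x = primMul θ 𝒜 a x)
    (hσ : ∀ a, ∀ x ∈ gen a, σ x = antiMul θ 𝒜 a x)
    (hε : ∀ a, ∀ x ∈ gen a, ε x = 0) :
    ∃ H : BraidedHopf θ 𝒜, ∀ a, ∀ x ∈ gen a, H.PrimitiveAt x := by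
  refine ⟨ofGenerators hθ h (LinearMap.applyₗ (1 ⊗ₜ 1) ∘ₗ ρ.toLinearMap) ε
    (LinearMap.applyₗ 1 ∘ₗ σ.toLinearMap) (by simp) (fun a x hx y => by simp [hρ a x hx]) hε
    (by simp) (fun a x hx y => by simp [hσ a x hx]), fun a x hx => ⟨?_, hε a x hx, ?_⟩⟩
  · change ρ x (1 ⊗ₜ 1) = _
    rw [hρ a x hx, primMul_tmul, twist_one 𝒜 hθ, mul_one, add_comm]
  · change σ x 1 = _
    rw [hσ a x hx, antiMul_apply, twist_one 𝒜 hθ, one_mul]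

end BraidedHopf

/-! ### Algebra maps that respect the gradings -/

variable {G' : Type*} [AddCommGroup G'] [Fintype G'] [DecidableEq G'] {θ' : G' → G' → ℂ}
  {B : Type*} [Ring B] [Algebra ℂ B] {ℬ : G' → Submodule ℂ B} [GradedAlgebra ℬ]

theorem map_twist {f : A →ₐ[ℂ] B} {φ : G → G'} (hφ : ∀ a b, θ' (φ a) (φ b) = θ a b)
    (hf : ∀ a, ∀ x ∈ 𝒜 a, f x ∈ ℬ (φ a)) (a : G) (x : A) :
    f (twist θ 𝒜 a x) = twist θ' ℬ (φ a) (f x) := by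
  induction x using DirectSum.Decomposition.inductionOn 𝒜 with
  | zero => simp
  | add m m' hm hm' => simp only [map_add, hm, hm']
  | homogeneous m =>
    rw [twist_of_mem 𝒜 a m.2, map_smul, twist_of_mem ℬ (φ a) (hf _ _ m.2), hφ]

theorem map_primMul {f : A →ₐ[ℂ] B} {φ : G → G'} (hφ : ∀ a b, θ' (φ a) (φ b) = θ a b)
    (hf : ∀ a, ∀ x ∈ 𝒜 a, f x ∈ ℬ (φ a)) (a : G) (x : A) (t : A ⊗[ℂ] A) :
    TensorProduct.map f.toLinearMap f.toLinearMap (primMul θ 𝒜 a x t) =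
      primMul θ' ℬ (φ a) (f x) (TensorProduct.map f.toLinearMap f.toLinearMap t) := by
  induction t using TensorProduct.induction_on with
  | zero => simp
  | add s t hs ht => simp only [map_add, hs, ht]
  | tmul z w => simp [map_twist hφ hf]

theorem map_antiMul {f : A →ₐ[ℂ] B} {φ : G → G'} (hφ : ∀ a b, θ' (φ a) (φ b) = θ a b)
    (hf : ∀ a, ∀ x ∈ 𝒜 a, f x ∈ ℬ (φ a)) (a : G) (x z : A) :
    f (antiMul θ 𝒜 a x z) = antiMul θ' ℬ (φ a) (f x) (f z) := by
  simp [map_twist hφ hf]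

/-- A graded algebra map preserves the Hopf structure as soon as it maps the primitive
generators to primitive elements. -/
theorem preservesHopf_of_primitive (hθ : IsCommutationFactor θ) (hθ' : IsCommutationFactor θ')
    (h : GeneratesGraded gen 𝒜) {H : BraidedHopf θ 𝒜} {K : BraidedHopf θ' ℬ} {f : A →ₐ[ℂ] B}
    {φ : G → G'} (hφ : ∀ a b, θ' (φ a) (φ b) = θ a b)
    (hf : ∀ a, ∀ x ∈ 𝒜 a, f x ∈ ℬ (φ a)) (hH : ∀ a, ∀ x ∈ gen a, H.PrimitiveAt x)
    (hK : ∀ a, ∀ x ∈ gen a, K.PrimitiveAt (f x)) : PreservesHopf H K f where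
  comul x := by
    have : K.comul ∘ₗ f.toLinearMap =
        TensorProduct.map f.toLinearMap f.toLinearMap ∘ₗ H.comul := by
      refine h.linearMap_ext (by simp [H.comul_one, K.comul_one]) fun a x hx y hy => ?_
      simp only [LinearMap.comp_apply, AlgHom.toLinearMap_apply, map_mul] at hy ⊢
      rw [H.comul_primitive_mul hθ (h.mem a x hx) (hH a x hx), map_primMul hφ hf,
        K.comul_primitive_mul hθ' (hf a x (h.mem a x hx)) (hK a x hx), hy]
    exact LinearMap.congr_fun this x
  counit x := by
    have : K.counit.comp f = H.counit := h.algHom_ext fun a x hx => by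
      rw [AlgHom.comp_apply, (hK a x hx).2.1, (hH a x hx).2.1]
    exact DFunLike.congr_fun this x
  antipode x := by
    have : K.antipode ∘ₗ f.toLinearMap = f.toLinearMap ∘ₗ H.antipode := by
      refine h.linearMap_ext (by simp [H.antipode_one, K.antipode_one]) fun a x hx y hy => ?_
      simp only [LinearMap.comp_apply, AlgHom.toLinearMap_apply, map_mul] at hy ⊢
      rw [H.antipode_primitive_mul (h.mem a x hx) (hH a x hx), map_antiMul hφ hf,
        K.antipode_primitive_mul (hf a x (h.mem a x hx)) (hK a x hx), hy]
    exact LinearMap.congr_fun this x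

end Generators

/-! ### The Hopf structures of the two algebras -/

theorem neg_one_pow_val_add (u v : ZMod 2) :
    (-1 : ℂ) ^ (u + v).val = (-1) ^ u.val * (-1) ^ v.val := by
  rw [ZMod.val_add, ← pow_add, neg_one_pow_eq_pow_mod_two (R := ℂ), Nat.mod_mod,
    ← neg_one_pow_eq_pow_mod_two]

theorem neg_one_pow_val_mul_self (u : ZMod 2) : (-1 : ℂ) ^ u.val * (-1) ^ u.val = 1 := by
  rw [← neg_one_pow_val_add, CharTwo.add_self_eq_zero, ZMod.val_zero, pow_zero]

theorem superSign_isCommutationFactor : IsCommutationFactor superSign where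
  add_left a b c := by rw [superSign, add_mul, neg_one_pow_val_add]; rfl
  add_right a b c := by rw [superSign, mul_add, neg_one_pow_val_add]; rfl
  mul_swap a b := by rw [superSign, superSign, mul_comm b a, neg_one_pow_val_mul_self]

theorem PBF.theta_eq (a b : ZMod 2 × ZMod 2) : θ a b = superSign a.1 b.1 * superSign a.2 b.2 := by
  rw [θ, neg_one_pow_val_add]; rfl

theorem PBF.theta_isCommutationFactor : IsCommutationFactor PBF.θ where
  add_left a b c := by
    simp only [PBF.theta_eq, Prod.fst_add, Prod.snd_add, superSign_isCommutationFactor.add_left]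
    ring
  add_right a b c := by
    simp only [PBF.theta_eq, Prod.fst_add, Prod.snd_add, superSign_isCommutationFactor.add_right]
    ring
  mul_swap a b := by
    rw [PBF.theta_eq, PBF.theta_eq, mul_mul_mul_comm, superSign_isCommutationFactor.mul_swap,
      superSign_isCommutationFactor.mul_swap, one_mul]

namespace LieSuperalgebra

variable {L : Type*} [AddCommGroup L] [Module ℂ L] {𝓛 : ZMod 2 → Submodule ℂ L}
  [DirectSum.Decomposition 𝓛] (S : LieSuperalgebra 𝓛)

theorem generatesGraded : GeneratesGraded S.gen S.grade := generatesGraded_wordSpan S.gen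

/-- The universal property of the enveloping algebra. -/
theorem exists_lift {E : Type*} [Ring E] [Algebra ℂ E] (T : L →ₗ[ℂ] E)
    (hT : ∀ a b, ∀ x ∈ 𝓛 a, ∀ y ∈ 𝓛 b,
      T (S.bracket x y) = T x * T y - superSign a b • (T y * T x)) :
    ∃ f : S.U →ₐ[ℂ] E, ∀ x, f (S.ι x) = T x := by
  refine ⟨RingQuot.liftAlgHom ℂ ⟨TensorAlgebra.lift ℂ T, ?_⟩, fun x => ?_⟩
  · rintro _ _ ⟨a, b, x, y, hx, hy⟩
    simp only [map_sub, map_mul, map_smul, TensorAlgebra.lift_ι_apply]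
    exact hT a b x hx y hy
  · exact (RingQuot.liftAlgHom_mkAlgHom_apply ℂ _ _ _).trans (TensorAlgebra.lift_ι_apply _ _)

/-- Linear maps on the enveloping algebra, one for each parity, that are compatible with the
supercommutators give a representation of the enveloping algebra. -/
theorem exists_lift_of_family {E : Type*} [Ring E] [Algebra ℂ E] (T : ZMod 2 → S.U →ₗ[ℂ] E)
    (hT : ∀ a b, ∀ x ∈ S.grade a, ∀ y ∈ S.grade b,
      T a x * T b y - superSign a b • (T b y * T a x) =
        T (a + b) (x * y - superSign a b • (y * x))) :
    ∃ f : S.U →ₐ[ℂ] E, ∀ a, ∀ x ∈ S.gen a, f x = T a x := by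
  let T' : L →ₗ[ℂ] E := DirectSum.toModule ℂ (ZMod 2) E
    (fun a => T a ∘ₗ S.ι ∘ₗ (𝓛 a).subtype) ∘ₗ (DirectSum.decomposeLinearEquiv 𝓛).toLinearMap
  have hT' : ∀ a, ∀ x ∈ 𝓛 a, T' x = T a (S.ι x) := fun a x hx => by
    have h : DirectSum.decompose 𝓛 x = DirectSum.lof ℂ (ZMod 2) (fun a => ↥(𝓛 a)) a ⟨x, hx⟩ :=
      DirectSum.decompose_of_mem 𝓛 hx
    simp only [T', LinearMap.comp_apply, LinearEquiv.coe_coe,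
      DirectSum.decomposeLinearEquiv_apply, h, DirectSum.toModule_lof, Submodule.subtype_apply]
  obtain ⟨f, hf⟩ := S.exists_lift T' fun a b x hx y hy => by
    rw [hT' a x hx, hT' b y hy, hT' _ _ (S.bracket_mem a b x hx y hy), S.ι_bracket hx hy]
    exact (hT a b _ (S.ι_mem hx) _ (S.ι_mem hy)).symm
  refine ⟨f, ?_⟩
  rintro a _ ⟨x, hx, rfl⟩
  rw [hf, hT' a x hx]

variable {S} in
theorem primitiveAt_ι_of_gen {H : BraidedHopf superSign S.grade}
    (hH : ∀ a, ∀ x ∈ S.gen a, H.PrimitiveAt x) (x : L) : H.PrimitiveAt (S.ι x) := by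
  induction x using DirectSum.Decomposition.inductionOn 𝓛 with
  | zero => rw [map_zero]; exact .zero H
  | add m m' hm hm' => rw [map_add]; exact hm.add hm'
  | homogeneous m => exact hH _ _ ⟨m, m.2, rfl⟩

theorem existsUnique_hopf :
    ∃! H : BraidedHopf superSign S.grade, ∀ x : L, H.PrimitiveAt (S.ι x) := by
  have hθ := superSign_isCommutationFactor
  obtain ⟨ρ, hρ⟩ := S.exists_lift_of_family (primMul superSign S.grade)
    fun a b x hx y hy => primMul_bracket S.grade hθ hx hy
  obtain ⟨σ, hσ⟩ := S.exists_lift_of_family (antiMul superSign S.grade)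
    fun a b x hx y hy => antiMul_bracket S.grade hθ hx hy
  -- zero is compatible with the supercommutators, so it extends to the counit
  obtain ⟨ε, hε⟩ := S.exists_lift (E := ℂ) 0 (by simp)
  obtain ⟨H, hH⟩ := BraidedHopf.exists_of_representations hθ S.generatesGraded ρ σ ε hρ hσ
    (by rintro a _ ⟨x, _, rfl⟩; exact hε x)
  refine ⟨H, primitiveAt_ι_of_gen hH, fun K hK => ?_⟩
  refine BraidedHopf.eq_of_primitive hθ S.generatesGraded ?_ hH
  rintro a _ ⟨x, _, rfl⟩
  exact hK x

end LieSuperalgebra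

namespace PBF

theorem generatesGraded : GeneratesGraded gen grade := generatesGraded_wordSpan gen

theorem bbb (i j k : ℕ) (ξ η ε : ℤˣ) : ringComm (antiComm (B i ξ) (B j η)) (B k ε) =
    ((ParaGen.sgn ε - ParaGen.sgn η) * ParaGen.delta j k) • B i ξ +
      ((ParaGen.sgn ε - ParaGen.sgn ξ) * ParaGen.delta i k) • B j η := by
  have h := mk_eq_of_rel (.bbb i j k ξ η ε)
  simp only [ringComm, antiComm, map_sub, map_add, map_mul, map_smul] at h
  exact h

theorem fff (i j k : ℕ) (ξ η ε : ℤˣ) : ringComm (ringComm (F i ξ) (F j η)) (F k ε) =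
    (1 / 2 * (ParaGen.sgn ε - ParaGen.sgn η) ^ 2 * ParaGen.delta j k) • F i ξ -
      (1 / 2 * (ParaGen.sgn ε - ParaGen.sgn ξ) ^ 2 * ParaGen.delta i k) • F j η := by
  have h := mk_eq_of_rel (.fff i j k ξ η ε)
  simp only [ringComm, map_sub, map_mul, map_smul] at h
  exact h

theorem bbf (k l m : ℕ) (ξ η ε : ℤˣ) : ringComm (antiComm (B k ξ) (B l η)) (F m ε) = 0 := by
  have h := mk_eq_of_rel (.bbf k l m ξ η ε)
  simp only [ringComm, antiComm, map_sub, map_add, map_mul, map_zero] at h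
  exact h

theorem ffb (k l m : ℕ) (ξ η ε : ℤˣ) : ringComm (ringComm (F k ξ) (F l η)) (B m ε) = 0 := by
  have h := mk_eq_of_rel (.ffb k l m ξ η ε)
  simp only [ringComm, map_sub, map_mul, map_zero] at h
  exact h

theorem bfb (k l m : ℕ) (ξ η ε : ℤˣ) : ringComm (antiComm (B k ξ) (F m η)) (B l ε) =
    ((ParaGen.sgn ε - ParaGen.sgn ξ) * ParaGen.delta k l) • F m η := by
  have h := mk_eq_of_rel (.bfb k l m ξ η ε)
  simp only [ringComm, antiComm, map_sub, map_add, map_mul, map_smul] at h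
  exact h

theorem bff (k l m : ℕ) (ξ η ε : ℤˣ) : antiComm (antiComm (B m ξ) (F k η)) (F l ε) =
    (1 / 2 * (ParaGen.sgn ε - ParaGen.sgn η) ^ 2 * ParaGen.delta k l) • B m ξ := by
  have h := mk_eq_of_rel (.bff k l m ξ η ε)
  simp only [antiComm, map_add, map_mul, map_smul] at h
  exact h

/-- All defining relations have the form `⟨⟨x, y⟩, z⟩ = (a combination of generators)` for the
coloured bracket `⟨x, y⟩ = xy - θ(deg x, deg y) yx`, so that every family of linear maps
compatible with the coloured brackets gives a representation of the relative parabose set. -/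
theorem exists_lift_of_family {E : Type*} [Ring E] [Algebra ℂ E]
    (T : ZMod 2 × ZMod 2 → PBF →ₗ[ℂ] E)
    (hT : ∀ a b, ∀ x ∈ grade a, ∀ y ∈ grade b,
      T a x * T b y - θ a b • (T b y * T a x) = T (a + b) (x * y - θ a b • (y * x))) :
    ∃ f : PBF →ₐ[ℂ] E, ∀ a, ∀ x ∈ gen a, f x = T a x := by
  have hc : ∀ a b c, ∀ x ∈ grade a, ∀ y ∈ grade b, θ a b = 1 → a + b = c →
      ringComm (T a x) (T b y) = T c (ringComm x y) := by
    rintro a b _ x hx y hy h rfl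
    simpa [h, ringComm] using hT a b x hx y hy
  have ha : ∀ a b c, ∀ x ∈ grade a, ∀ y ∈ grade b, θ a b = -1 → a + b = c →
      antiComm (T a x) (T b y) = T c (antiComm x y) := by
    rintro a b _ x hx y hy h rfl
    simpa [h, antiComm] using hT a b x hx y hy
  have θ1 : θ (1, 0) (1, 0) = -1 := by simp [θ, ZMod.val_one]
  have θ2 : θ (1, 1) (1, 1) = 1 := by simp [θ, CharTwo.add_self_eq_zero]
  have θ3 : θ (1, 0) (1, 1) = -1 := by simp [θ, ZMod.val_one]
  have θ4 : ∀ b, θ (0, 0) b = 1 := fun b => by simp [θ]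
  have θ5 : θ (0, 1) (1, 0) = 1 := by simp [θ]
  have θ6 : θ (0, 1) (1, 1) = -1 := by simp [θ, ZMod.val_one]
  have hBB : ∀ i j ξ η, antiComm (B i ξ) (B j η) ∈ grade (0, 0) := fun i j ξ η =>
    L00_le (Submodule.subset_span (.inl ⟨i, j, ξ, η, rfl⟩))
  have hFF : ∀ i j ξ η, ringComm (F i ξ) (F j η) ∈ grade (0, 0) := fun i j ξ η =>
    L00_le (Submodule.subset_span (.inr ⟨i, j, ξ, η, rfl⟩))
  have hBF : ∀ i j ξ η, antiComm (B i ξ) (F j η) ∈ grade (0, 1) := fun i j ξ η =>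
    L01_le (Submodule.subset_span ⟨j, i, η, ξ, add_comm _ _⟩)
  let f₀ : FreeAlgebra ℂ ParaGen →ₐ[ℂ] E := FreeAlgebra.lift ℂ fun g => T g.deg (ι g)
  have fB : ∀ i ξ, f₀ (ParaGen.b i ξ) = T (1, 0) (B i ξ) := fun i ξ => FreeAlgebra.lift_ι_apply _ _
  have fF : ∀ i ξ, f₀ (ParaGen.f i ξ) = T (1, 1) (F i ξ) := fun i ξ => FreeAlgebra.lift_ι_apply _ _
  have fc : ∀ x y, f₀ (ringComm x y) = ringComm (f₀ x) (f₀ y) := fun x y => by simp [ringComm]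
  have fa : ∀ x y, f₀ (antiComm x y) = antiComm (f₀ x) (f₀ y) := fun x y => by simp [antiComm]
  refine ⟨RingQuot.liftAlgHom ℂ ⟨f₀, ?_⟩, ?_⟩
  · intro x y h
    cases h with
    | bbb i j k ξ η ε =>
      rw [fc, fa, fB, fB, fB, ha _ _ (0, 0) _ (B_mem i ξ) _ (B_mem j η) θ1 (by decide),
        hc _ _ (1, 0) _ (hBB i j ξ η) _ (B_mem k ε) (θ4 _) (by decide), bbb]
      simp only [map_add, map_smul, fB]
    | fff i j k ξ η ε =>
      rw [fc, fc, fF, fF, fF, hc _ _ (0, 0) _ (F_mem i ξ) _ (F_mem j η) θ2 (by decide),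
        hc _ _ (1, 1) _ (hFF i j ξ η) _ (F_mem k ε) (θ4 _) (by decide), fff]
      simp only [map_sub, map_smul, fF]
    | bbf k l m ξ η ε =>
      rw [fc, fa, fB, fB, fF, ha _ _ (0, 0) _ (B_mem k ξ) _ (B_mem l η) θ1 (by decide),
        hc _ _ (1, 1) _ (hBB k l ξ η) _ (F_mem m ε) (θ4 _) (by decide), bbf, map_zero, map_zero]
    | ffb k l m ξ η ε =>
      rw [fc, fc, fF, fF, fB, hc _ _ (0, 0) _ (F_mem k ξ) _ (F_mem l η) θ2 (by decide),
        hc _ _ (1, 0) _ (hFF k l ξ η) _ (B_mem m ε) (θ4 _) (by decide), ffb, map_zero, map_zero]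
    | bfb k l m ξ η ε =>
      rw [fc, fa, fB, fF, fB, ha _ _ (0, 1) _ (B_mem k ξ) _ (F_mem m η) θ3 (by decide),
        hc _ _ (1, 1) _ (hBF k m ξ η) _ (B_mem l ε) θ5 (by decide), bfb]
      simp only [map_smul, fF]
    | bff k l m ξ η ε =>
      rw [fa, fa, fB, fF, fF, ha _ _ (0, 1) _ (B_mem m ξ) _ (F_mem k η) θ3 (by decide),
        ha _ _ (1, 0) _ (hBF m k ξ η) _ (F_mem l ε) θ6 (by decide), bff]
      simp only [map_smul, fB]
  · rintro _ _ ⟨g, rfl, rfl⟩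
    exact (RingQuot.liftAlgHom_mkAlgHom_apply ℂ _ _ _).trans (FreeAlgebra.lift_ι_apply _ _)

theorem primitiveAt_of_mem_gen {H : BraidedHopf θ grade}
    (hH : ∀ (i : ℕ) (ξ : ℤˣ), H.PrimitiveAt (B i ξ) ∧ H.PrimitiveAt (F i ξ))
    (a : ZMod 2 × ZMod 2) (x : PBF) (hx : x ∈ gen a) : H.PrimitiveAt x := by
  obtain ⟨_ | _, -, rfl⟩ := hx
  exacts [(hH _ _).1, (hH _ _).2]

theorem existsUnique_hopf : ∃! H : BraidedHopf θ grade,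
    ∀ (i : ℕ) (ξ : ℤˣ), H.PrimitiveAt (B i ξ) ∧ H.PrimitiveAt (F i ξ) := by
  have hθ := theta_isCommutationFactor
  obtain ⟨ρ, hρ⟩ := exists_lift_of_family (primMul θ grade)
    fun a b x hx y hy => primMul_bracket grade hθ hx hy
  obtain ⟨σ, hσ⟩ := exists_lift_of_family (antiMul θ grade)
    fun a b x hx y hy => antiMul_bracket grade hθ hx hy
  -- zero is compatible with the coloured brackets, so it extends to the counit
  obtain ⟨ε, hε⟩ := exists_lift_of_family (E := ℂ) 0 (by simp)
  obtain ⟨H, hH⟩ := BraidedHopf.exists_of_representations hθ generatesGraded ρ σ ε hρ hσ hε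
  exact ⟨H, fun i ξ => ⟨hH (1, 0) _ ⟨.B i ξ, rfl, rfl⟩, hH (1, 1) _ ⟨.F i ξ, rfl, rfl⟩⟩,
    fun K hK => BraidedHopf.eq_of_primitive hθ generatesGraded (primitiveAt_of_mem_gen hK) hH⟩

end PBF

/-! ### Matrix units in the relative parabose set and the realization -/

theorem superSign_zero_left (b : ZMod 2) : superSign 0 b = 1 := by simp [superSign]

theorem superSign_zero_right (a : ZMod 2) : superSign a 0 = 1 := by simp [superSign]

theorem superSign_one_one : superSign 1 1 = -1 := by simp [superSign, ZMod.val_one]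

theorem superSign_comm (a b : ZMod 2) : superSign a b = superSign b a := by
  rw [superSign, superSign, mul_comm]

theorem superSign_mul_self (a b : ZMod 2) : superSign a b * superSign a b = 1 :=
  neg_one_pow_val_mul_self _

namespace PBF

variable {m n : ℕ}

/-- The parity of a basis index of `ℂ^(m|n)`. -/
def parity : Fin m ⊕ Fin n → ZMod 2 := Sum.elim 0 1

/-- The generator `B_k^ξ` or `F_α^ξ` that belongs to a basis index of `ℂ^(m|n)`. -/
noncomputable def para (i : Fin m ⊕ Fin n) (ξ : ℤˣ) : PBF :=
  Sum.elim (fun k : Fin m => B k ξ) (fun α : Fin n => F α ξ) i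

/-- Half the coloured bracket of the creation operator of index `i` and the annihilation operator
of index `j`; these elements satisfy the relations of the matrix units of `gl(m|n)`. -/
noncomputable def matUnit (i j : Fin m ⊕ Fin n) : PBF :=
  (1 / 2 : ℂ) • (para i 1 * para j (-1) +
    superSign (parity i) (parity j) • (para j (-1) * para i 1))

@[simp] theorem matUnit_inl_inl (k l : Fin m) :
    matUnit (n := n) (.inl k) (.inl l) = (1 / 2 : ℂ) • antiComm (B k 1) (B l (-1)) := by
  simp [matUnit, para, parity, superSign_zero_left, antiComm]

@[simp] theorem matUnit_inl_inr (k : Fin m) (α : Fin n) :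
    matUnit (.inl k) (.inr α) = (1 / 2 : ℂ) • antiComm (B k 1) (F α (-1)) := by
  simp [matUnit, para, parity, superSign_zero_left, antiComm]

@[simp] theorem matUnit_inr_inl (α : Fin n) (k : Fin m) :
    matUnit (.inr α) (.inl k) = (1 / 2 : ℂ) • antiComm (F α 1) (B k (-1)) := by
  simp [matUnit, para, parity, superSign_zero_right, antiComm]

@[simp] theorem matUnit_inr_inr (α β : Fin n) :
    matUnit (m := m) (.inr α) (.inr β) = (1 / 2 : ℂ) • ringComm (F α 1) (F β (-1)) := by
  simp [matUnit, para, parity, superSign_one_one, ringComm, sub_eq_add_neg]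

theorem ringComm_smul_left (c : ℂ) (x y : PBF) : ringComm (c • x) y = c • ringComm x y := by
  rw [ringComm, ringComm, smul_mul_assoc, mul_smul_comm, smul_sub]

theorem antiComm_smul_left (c : ℂ) (x y : PBF) : antiComm (c • x) y = c • antiComm x y := by
  rw [antiComm, antiComm, smul_mul_assoc, mul_smul_comm, smul_add]

theorem sub_one_smul_eq_ringComm (x y : PBF) : x * y - (1 : ℂ) • (y * x) = ringComm x y := by
  rw [one_smul]; rfl

theorem sub_neg_one_smul_eq_antiComm (x y : PBF) :
    x * y - (-1 : ℂ) • (y * x) = antiComm x y := by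
  rw [neg_one_smul, sub_neg_eq_add]; rfl

theorem antiComm_comm (x y : PBF) : antiComm x y = antiComm y x := add_comm _ _

theorem sgn_one : ParaGen.sgn 1 = 1 := by simp [ParaGen.sgn]

theorem sgn_neg_one : ParaGen.sgn (-1) = -1 := by simp [ParaGen.sgn]

/-- The matrix units act on the creation operators by the standard representation. -/
theorem matUnit_bracket_para_one (i j k : Fin m ⊕ Fin n) :
    matUnit i j * para k 1 - superSign (parity i + parity j) (parity k) • (para k 1 * matUnit i j) =
      if j = k then para i 1 else 0 := by
  have h2 : (1 : ZMod 2) + 1 = 0 := by decide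
  -- each choice of parities is one of the six families of defining relations
  rcases i with i | i <;> rcases j with j | j <;> rcases k with k | k <;>
    simp only [matUnit_inl_inl, matUnit_inl_inr, matUnit_inr_inl, matUnit_inr_inr, para, parity,
      Sum.elim_inl, Sum.elim_inr, Pi.zero_apply, Pi.one_apply, add_zero, zero_add, h2,
      superSign_zero_left, superSign_zero_right, superSign_one_one, ringComm_smul_left, antiComm_smul_left,
      sub_one_smul_eq_ringComm, sub_neg_one_smul_eq_antiComm, bbb, fff, bbf, ffb, bfb, bff,
      antiComm_comm (F _ _) (B _ _), sgn_one, sgn_neg_one, sub_self, zero_mul, zero_smul,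
      add_zero, smul_zero, ParaGen.delta, Fin.val_inj, Sum.inl.injEq, Sum.inr.injEq,
      reduceCtorEq, if_false] <;>
    (try split_ifs) <;> simp [smul_smul] <;> norm_num

/-- The matrix units act on the annihilation operators by the dual of the standard
representation. -/
theorem matUnit_bracket_para_neg_one (i j k : Fin m ⊕ Fin n) :
    matUnit i j * para k (-1) -
        superSign (parity i + parity j) (parity k) • (para k (-1) * matUnit i j) =
      if i = k then -(superSign (parity i) (parity i + parity j) • para j (-1)) else 0 := by
  have h2 : (1 : ZMod 2) + 1 = 0 := by decide
  -- each choice of parities is one of the six families of defining relations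
  rcases i with i | i <;> rcases j with j | j <;> rcases k with k | k <;>
    simp only [matUnit_inl_inl, matUnit_inl_inr, matUnit_inr_inl, matUnit_inr_inr, para, parity,
      Sum.elim_inl, Sum.elim_inr, Pi.zero_apply, Pi.one_apply, add_zero, zero_add, h2,
      superSign_zero_left, superSign_zero_right, superSign_one_one, ringComm_smul_left, antiComm_smul_left,
      sub_one_smul_eq_ringComm, sub_neg_one_smul_eq_antiComm, bbb, fff, bbf, ffb, bfb, bff,
      antiComm_comm (F _ _) (B _ _), sgn_one, sgn_neg_one, sub_self, zero_mul, zero_smul,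
      add_zero, smul_zero, ParaGen.delta, Fin.val_inj, Sum.inl.injEq, Sum.inr.injEq,
      reduceCtorEq, if_false] <;>
    (try split_ifs) <;> simp [smul_smul] <;> norm_num

/-- The derivation rule for a coloured bracket with `e`, where `⟨e, x⟩ = u` and `⟨e, y⟩ = v`. -/
theorem mul_coloured_bracket {R : Type*} [Ring R] [Algebra ℂ R] {e x y u v : R} {α β : ℂ} (t : ℂ)
    (hx : e * x - α • (x * e) = u) (hy : e * y - β • (y * e) = v) :
    e * (x * y + t • (y * x)) - (α * β) • ((x * y + t • (y * x)) * e) =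
      (u * y + (t * β) • (y * u)) + (α • (x * v) + t • (v * x)) := by
  rw [← hx, ← hy]
  simp only [mul_add, add_mul, mul_sub, sub_mul, mul_smul_comm, smul_mul_assoc, mul_assoc]
  module

/-- The matrix units satisfy the relations of `gl(m|n)`: the first term comes from the action on
the creation operator in `matUnit k l`, the second from that on the annihilation operator. -/
theorem matUnit_bracket_matUnit (i j k l : Fin m ⊕ Fin n) :
    matUnit i j * matUnit k l - superSign (parity i + parity j) (parity k + parity l) •
        (matUnit k l * matUnit i j) =
      (if j = k then matUnit i l else 0) -
        superSign (parity i + parity j) (parity k + parity l) •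
          (if l = i then matUnit k j else 0) := by
  have hs := superSign_isCommutationFactor
  have key := mul_coloured_bracket (superSign (parity k) (parity l))
    (matUnit_bracket_para_one i j k) (matUnit_bracket_para_neg_one i j l)
  rw [← hs.add_right] at key
  conv_lhs => rw [matUnit.eq_def k l, mul_smul_comm, smul_mul_assoc, smul_comm _ (1 / 2 : ℂ),
    ← smul_sub, key, smul_add]
  rw [sub_eq_add_neg]
  congr 1
  · -- for `j = k` the signs combine to that of `matUnit i l`, because `k + k` is even
    split_ifs with h
    · subst h
      rw [matUnit, ← hs.add_left, add_left_comm, CharTwo.add_self_eq_zero, add_zero]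
    · simp
  · by_cases h : l = i
    · subst h
      simp only [if_true, matUnit, mul_neg, neg_mul, mul_smul_comm, smul_mul_assoc, smul_neg,
        smul_smul, smul_add, hs.add_left, hs.add_right, ← neg_add]
      congr 2
      · congr 1
        rw [superSign_comm (parity l) (parity k), superSign_comm (parity l) (parity j)]
        ring
      · congr 1
        have h := superSign_mul_self (parity j) (parity k)
        rw [superSign_comm (parity k) (parity l), superSign_comm (parity k) (parity j),
          superSign_comm (parity l) (parity j)]
        linear_combination (-(superSign (parity l) (parity k) * superSign (parity l) (parity l) *
          superSign (parity j) (parity l)) / 2) * h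
    · simp [h, Ne.symm h]

/-- The realization of `gl(m|n)`: the linear combination of the matrix units with the entries of
a matrix as coefficients. -/
noncomputable def realize : Matrix (Fin m ⊕ Fin n) (Fin m ⊕ Fin n) ℂ →ₗ[ℂ] PBF where
  toFun M := ∑ p : (Fin m ⊕ Fin n) × (Fin m ⊕ Fin n), M p.1 p.2 • matUnit p.1 p.2
  map_add' M N := by simp only [Matrix.add_apply, add_smul, Finset.sum_add_distrib]
  map_smul' c M := by
    simp only [Matrix.smul_apply, smul_assoc, Finset.smul_sum, RingHom.id_apply]

theorem realize_apply (M : Matrix (Fin m ⊕ Fin n) (Fin m ⊕ Fin n) ℂ) :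
    realize M = ∑ p : (Fin m ⊕ Fin n) × (Fin m ⊕ Fin n), M p.1 p.2 • matUnit p.1 p.2 := rfl

theorem realize_mul (M N : Matrix (Fin m ⊕ Fin n) (Fin m ⊕ Fin n) ℂ) :
    realize (M * N) = ∑ p : (Fin m ⊕ Fin n) × (Fin m ⊕ Fin n),
      ∑ q : (Fin m ⊕ Fin n) × (Fin m ⊕ Fin n),
        (M p.1 p.2 * N q.1 q.2) • (if p.2 = q.1 then matUnit p.1 q.2 else 0) := by
  simp only [realize_apply, Matrix.mul_apply, Finset.sum_smul, Fintype.sum_prod_type, smul_ite,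
    smul_zero]
  refine Finset.sum_congr rfl fun i _ => ?_
  rw [Finset.sum_comm]
  refine Finset.sum_congr rfl fun j _ => ?_
  rw [Finset.sum_comm]
  simp

/-- The matrix is homogeneous of parity `a`. -/
def IsHomogeneous (M : Matrix (Fin m ⊕ Fin n) (Fin m ⊕ Fin n) ℂ) (a : ZMod 2) : Prop :=
  ∀ i j, parity i + parity j ≠ a → M i j = 0

theorem realize_bracket {M N : Matrix (Fin m ⊕ Fin n) (Fin m ⊕ Fin n) ℂ} {a b : ZMod 2}
    (hM : IsHomogeneous M a) (hN : IsHomogeneous N b) :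
    realize (M * N - superSign a b • (N * M)) =
      realize M * realize N - superSign a b • (realize N * realize M) := by
  have h1 : realize (N * M) = ∑ p : (Fin m ⊕ Fin n) × (Fin m ⊕ Fin n),
      ∑ q : (Fin m ⊕ Fin n) × (Fin m ⊕ Fin n),
        (M p.1 p.2 * N q.1 q.2) • (if q.2 = p.1 then matUnit q.1 p.2 else 0) := by
    rw [realize_mul, Finset.sum_comm]
    simp only [mul_comm]
  have h2 : realize N * realize M = ∑ p : (Fin m ⊕ Fin n) × (Fin m ⊕ Fin n),
      ∑ q : (Fin m ⊕ Fin n) × (Fin m ⊕ Fin n),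
        (M p.1 p.2 * N q.1 q.2) • (matUnit q.1 q.2 * matUnit p.1 p.2) := by
    rw [realize_apply, realize_apply, Finset.sum_mul_sum, Finset.sum_comm]
    simp only [smul_mul_smul_comm, mul_comm (M _ _)]
  have h3 : realize M * realize N = ∑ p : (Fin m ⊕ Fin n) × (Fin m ⊕ Fin n),
      ∑ q : (Fin m ⊕ Fin n) × (Fin m ⊕ Fin n),
        (M p.1 p.2 * N q.1 q.2) • (matUnit p.1 p.2 * matUnit q.1 q.2) := by
    rw [realize_apply, realize_apply, Finset.sum_mul_sum]
    simp only [smul_mul_smul_comm]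
  rw [map_sub, map_smul, realize_mul, h1, h2, h3]
  simp only [Finset.smul_sum, ← Finset.sum_sub_distrib]
  refine Finset.sum_congr rfl fun p _ => Finset.sum_congr rfl fun q _ => ?_
  rw [smul_comm (superSign a b), smul_comm (superSign a b), ← smul_sub, ← smul_sub]
  by_cases hp : parity p.1 + parity p.2 = a
  · by_cases hq : parity q.1 + parity q.2 = b
    · rw [← hp, ← hq, matUnit_bracket_matUnit]
    · rw [hN _ _ hq, mul_zero, zero_smul, zero_smul]
  · rw [hM _ _ hp, zero_mul, zero_smul, zero_smul]

/-- `L₀₀` and `L₀₁`, indexed by their parity. -/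
noncomputable def lieSpan (a : ZMod 2) : Submodule ℂ PBF := if a = 0 then L00 else L01

theorem matUnit_mem_lieSpan (i j : Fin m ⊕ Fin n) :
    matUnit i j ∈ lieSpan (parity i + parity j) := by
  have h2 : (1 : ZMod 2) + 1 = 0 := by decide
  rcases i with i | i <;> rcases j with j | j <;>
    simp only [matUnit_inl_inl, matUnit_inl_inr, matUnit_inr_inl, matUnit_inr_inr, lieSpan,
      parity, Sum.elim_inl, Sum.elim_inr, Pi.zero_apply, Pi.one_apply, add_zero, zero_add, h2,
      if_true, one_ne_zero, if_false] <;>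
    refine Submodule.smul_mem _ _ (Submodule.subset_span ?_)
  · exact .inl ⟨i, j, 1, -1, rfl⟩
  · exact ⟨j, i, -1, 1, antiComm_comm _ _⟩
  · exact ⟨i, j, 1, -1, rfl⟩
  · exact .inr ⟨i, j, 1, -1, rfl⟩

theorem realize_mem_lieSpan {M : Matrix (Fin m ⊕ Fin n) (Fin m ⊕ Fin n) ℂ} {a : ZMod 2}
    (hM : IsHomogeneous M a) : realize M ∈ lieSpan a := by
  refine Submodule.sum_mem _ fun p _ => ?_
  by_cases hp : parity p.1 + parity p.2 = a
  · exact Submodule.smul_mem _ _ (hp ▸ matUnit_mem_lieSpan p.1 p.2)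
  · rw [hM _ _ hp, zero_smul]
    exact Submodule.zero_mem _

end PBF

section Realization

open PBF

variable {L : Type*} [AddCommGroup L] [Module ℂ L] {𝓛 : ZMod 2 → Submodule ℂ L}
  [DirectSum.Decomposition 𝓛] {S : LieSuperalgebra 𝓛} {m n : ℕ} (P : GradedMatrixRep S m n)

theorem GradedMatrixRep.isHomogeneous {a : ZMod 2} {x : L} (hx : x ∈ 𝓛 a) :
    IsHomogeneous (P.toFun x) a := by
  obtain rfl | rfl : a = 0 ∨ a = 1 := by
    clear hx; revert a; decide
  · obtain ⟨h1, h2⟩ := P.even x hx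
    rintro (i | i) (j | j) hij
    · exact absurd rfl hij
    · exact congrFun (congrFun h1 i) j
    · exact congrFun (congrFun h2 i) j
    · exact absurd rfl hij
  · obtain ⟨h1, h2⟩ := P.odd x hx
    rintro (i | i) (j | j) hij
    · exact congrFun (congrFun h1 i) j
    · exact absurd rfl hij
    · exact absurd rfl hij
    · exact congrFun (congrFun h2 i) j

/-- The two prescriptions for `J`, on even and on odd elements, are one formula: the matrix units
combined with the coefficients of the representing matrix. -/
theorem isParaRealization_iff (J : S.U →ₐ[ℂ] PBF) :
    IsParaRealization P J ↔ ∀ x, J (S.ι x) = realize (P.toFun x) := by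
  have heven : ∀ X ∈ 𝓛 0, realize (P.toFun X) =
      (1 / 2 : ℂ) • ∑ k : Fin m, ∑ l : Fin m, P.A X k l • antiComm (PBF.B k 1) (PBF.B l (-1)) +
      (1 / 2 : ℂ) • ∑ α : Fin n, ∑ β : Fin n,
        P.D X α β • ringComm (PBF.F α 1) (PBF.F β (-1)) := fun X hX => by
    have h12 : ∀ k α, P.toFun X (.inl k) (.inr α) = 0 := fun k α =>
      P.isHomogeneous hX _ _ (by simp [parity])
    have h21 : ∀ k α, P.toFun X (.inr α) (.inl k) = 0 := fun k α =>
      P.isHomogeneous hX _ _ (by simp [parity])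
    simp only [realize_apply, Fintype.sum_prod_type, Fintype.sum_sum_type, h12, h21, zero_smul,
      Finset.sum_const_zero, add_zero, zero_add, matUnit_inl_inl, matUnit_inr_inr,
      Finset.smul_sum, smul_comm (1 / 2 : ℂ)]
    rfl
  have hodd : ∀ Y ∈ 𝓛 1, realize (P.toFun Y) =
      (1 / 2 : ℂ) • ∑ k : Fin m, ∑ α : Fin n,
        (P.B Y k α • antiComm (PBF.B k 1) (PBF.F α (-1)) +
          P.C Y α k • antiComm (PBF.F α 1) (PBF.B k (-1))) := fun Y hY => by
    have h11 : ∀ k l, P.toFun Y (.inl k) (.inl l) = 0 := fun k l =>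
      P.isHomogeneous hY _ _ (by simp [parity])
    have h22 : ∀ α β, P.toFun Y (.inr α) (.inr β) = 0 := fun α β =>
      P.isHomogeneous hY _ _ (by simp [parity, CharTwo.add_self_eq_zero])
    simp only [realize_apply, Fintype.sum_prod_type, Fintype.sum_sum_type, h11, h22, zero_smul,
      Finset.sum_const_zero, add_zero, zero_add, matUnit_inl_inr, matUnit_inr_inl,
      Finset.smul_sum, Finset.sum_add_distrib, smul_add, smul_comm (1 / 2 : ℂ)]
    rw [add_comm]
    refine congrArg₂ _ rfl ?_
    rw [Finset.sum_comm]
    rfl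
  constructor
  · rintro ⟨h0, h1⟩ x
    induction x using DirectSum.Decomposition.inductionOn 𝓛 with
    | zero => simp
    | add x y hx hy => simp only [map_add, hx, hy]
    | @homogeneous a x =>
      obtain rfl | rfl : a = 0 ∨ a = 1 := by
        clear x; revert a; decide
      · rw [h0 _ x.2, heven _ x.2]
      · rw [h1 _ x.2, hodd _ x.2]
  · intro h
    exact ⟨fun X hX => by rw [h, heven X hX], fun Y hY => by rw [h, hodd Y hY]⟩

theorem existsUnique_isParaRealization : ∃! J : S.U →ₐ[ℂ] PBF, IsParaRealization P J := by
  simp only [isParaRealization_iff]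
  obtain ⟨J, hJ⟩ := S.exists_lift (realize ∘ₗ P.toFun) fun a b x hx y hy => by
    rw [LinearMap.comp_apply, P.map_bracket a b x hx y hy,
      realize_bracket (P.isHomogeneous hx) (P.isHomogeneous hy)]
    rfl
  refine ⟨J, hJ, fun K hK => S.generatesGraded.algHom_ext ?_⟩
  rintro a _ ⟨x, _, rfl⟩
  rw [hK, hJ]
  rfl

end Realization

/-! ### The subalgebra `W` -/

namespace PBF

theorem lieSpan_zero : lieSpan 0 = L00 := if_pos rfl

theorem lieSpan_one : lieSpan 1 = L01 := if_neg one_ne_zero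

theorem lieSpan_le_grade (a : ZMod 2) : lieSpan a ≤ grade (0, a) := by
  obtain rfl | rfl : a = 0 ∨ a = 1 := by
    revert a; decide
  · exact lieSpan_zero ▸ L00_le
  · exact lieSpan_one ▸ L01_le

theorem lieSpan_le_W {a : ZMod 2} {x : PBF} (hx : x ∈ lieSpan a) : x ∈ W := by
  refine Algebra.subset_adjoin ?_
  obtain rfl | rfl : a = 0 ∨ a = 1 := by
    clear hx; revert a; decide
  · exact .inl (lieSpan_zero ▸ hx)
  · exact .inr (lieSpan_one ▸ hx)

/-- The homogeneous generators of `W`. -/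
def genW (a : ZMod 2) : Set W := {w | (w : PBF) ∈ lieSpan a}

theorem generatesGraded_genW : GeneratesGraded genW gradeW := by
  refine .of_adjoin_eq_top (fun a x hx => lieSpan_le_grade a hx) ?_
  have h : (⋃ a, genW a) = ((↑) : W → PBF) ⁻¹' ((L00 : Set PBF) ∪ (L01 : Set PBF)) := by
    ext w
    simp only [Set.mem_iUnion, genW, Set.mem_ofPred_eq, Set.mem_preimage, Set.mem_union,
      SetLike.mem_coe]
    constructor
    · rintro ⟨a, ha⟩
      obtain rfl | rfl : a = 0 ∨ a = 1 := by
        clear ha; revert a; decide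
      · exact .inl (lieSpan_zero ▸ ha)
      · exact .inr (lieSpan_one ▸ ha)
    · rintro (h | h)
      · exact ⟨0, lieSpan_zero ▸ h⟩
      · exact ⟨1, lieSpan_one ▸ h⟩
  rw [h]
  exact Algebra.adjoin_adjoin_coe_preimage

theorem theta_zero_zero (a b : ZMod 2) : θ (0, a) (0, b) = superSign a b := by
  rw [theta_eq, superSign_zero_left, one_mul]

theorem val_mem_grade (a : ZMod 2) (w : W) (hw : w ∈ gradeW a) : W.val w ∈ grade (0, a) := hw

/-- Coloured brackets of primitive elements are primitive, so `L₀₀` and `L₀₁` are. -/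
theorem primitiveAt_of_mem_lieSpan {H : BraidedHopf θ grade}
    (hH : ∀ (i : ℕ) (ξ : ℤˣ), H.PrimitiveAt (B i ξ) ∧ H.PrimitiveAt (F i ξ)) {a : ZMod 2} {x : PBF}
    (hx : x ∈ lieSpan a) : H.PrimitiveAt x := by
  have hθ := theta_isCommutationFactor
  have hBB : ∀ k l ε η, H.PrimitiveAt (antiComm (B k ε) (B l η)) := fun k l ε η => by
    have h := BraidedHopf.PrimitiveAt.bracket hθ (B_mem k ε) (B_mem l η) (hH k ε).1 (hH l η).1
    rwa [show θ (1, 0) (1, 0) = -1 by simp [θ, ZMod.val_one], sub_neg_one_smul_eq_antiComm] at h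
  have hFF : ∀ k l ε η, H.PrimitiveAt (ringComm (F k ε) (F l η)) := fun k l ε η => by
    have h := BraidedHopf.PrimitiveAt.bracket hθ (F_mem k ε) (F_mem l η) (hH k ε).2 (hH l η).2
    rwa [show θ (1, 1) (1, 1) = 1 by simp [θ, CharTwo.add_self_eq_zero],
      sub_one_smul_eq_ringComm] at h
  have hFB : ∀ k l ε η, H.PrimitiveAt (antiComm (F k ε) (B l η)) := fun k l ε η => by
    have h := BraidedHopf.PrimitiveAt.bracket hθ (F_mem k ε) (B_mem l η) (hH k ε).2 (hH l η).1
    rwa [show θ (1, 1) (1, 0) = -1 by simp [θ, ZMod.val_one], sub_neg_one_smul_eq_antiComm] at h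
  obtain rfl | rfl : a = 0 ∨ a = 1 := by
    clear hx; revert a; decide
  · rw [lieSpan_zero, L00] at hx
    induction hx using Submodule.span_induction with
    | mem x hx =>
      obtain ⟨k, l, ε, η, rfl⟩ | ⟨k, l, ε, η, rfl⟩ := hx
      exacts [hBB k l ε η, hFF k l ε η]
    | zero => exact .zero H
    | add x y _ _ hx hy => exact hx.add hy
    | smul c x _ hx => exact hx.smul c
  · rw [lieSpan_one, L01] at hx
    induction hx using Submodule.span_induction with
    | mem x hx =>
      obtain ⟨k, l, ε, η, rfl⟩ := hx
      exact hFB k l ε η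
    | zero => exact .zero H
    | add x y _ _ hx hy => exact hx.add hy
    | smul c x _ hx => exact hx.smul c

/-- The inclusion of the tensor square of `W`. -/
noncomputable abbrev inclW : W ⊗[ℂ] W →ₗ[ℂ] PBF ⊗[ℂ] PBF :=
  TensorProduct.map W.val.toLinearMap W.val.toLinearMap

theorem inclW_injective : Function.Injective inclW :=
  TensorProduct.map_injective_of_flat_flat _ _ Subtype.val_injective Subtype.val_injective

/-- The Hopf structure of the relative parabose set restricts to `W`: since `W` is generated by
primitive elements, the comultiplication and the antipode map it to `W ⊗ W` and `W`. -/
theorem exists_hopf_W {H : BraidedHopf θ grade}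
    (hH : ∀ (i : ℕ) (ξ : ℤˣ), H.PrimitiveAt (B i ξ) ∧ H.PrimitiveAt (F i ξ)) :
    ∃ K : BraidedHopf superSign gradeW, PreservesHopf K H W.val ∧
      ∀ a, ∀ w ∈ genW a, K.PrimitiveAt w := by
  have hθ := theta_isCommutationFactor
  have hgen := generatesGraded_genW
  have hprim : ∀ a, ∀ w ∈ genW a, H.PrimitiveAt (W.val w) := fun a w hw =>
    primitiveAt_of_mem_lieSpan hH hw
  have hmem : ∀ a, ∀ w ∈ genW a, W.val w ∈ grade (0, a) := fun a w hw => lieSpan_le_grade a hw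
  have hrange : ∀ w : W, H.comul (W.val w) ∈ LinearMap.range inclW :=
    hgen.mem_submodule (N := (LinearMap.range inclW).comap (H.comul ∘ₗ W.val.toLinearMap))
      ⟨1 ⊗ₜ 1, by simp [H.comul_one]⟩ <| by
      rintro a x hx y ⟨t, ht⟩
      refine ⟨primMul superSign gradeW a x t, ?_⟩
      rw [map_primMul theta_zero_zero val_mem_grade, ht]
      simp only [LinearMap.comp_apply, AlgHom.toLinearMap_apply, map_mul]
      rw [H.comul_primitive_mul hθ (hmem a x hx) (hprim a x hx)]
  have hanti : ∀ w : W, H.antipode (W.val w) ∈ LinearMap.range W.val.toLinearMap :=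
    hgen.mem_submodule
      (N := (LinearMap.range W.val.toLinearMap).comap (H.antipode ∘ₗ W.val.toLinearMap))
      ⟨1, by simp [H.antipode_one]⟩ <| by
      rintro a x hx y ⟨t, ht⟩
      refine ⟨antiMul superSign gradeW a x t, ?_⟩
      rw [AlgHom.toLinearMap_apply] at ht ⊢
      rw [map_antiMul theta_zero_zero val_mem_grade, ht]
      simp only [LinearMap.comp_apply, AlgHom.toLinearMap_apply, map_mul]
      rw [H.antipode_primitive_mul (hmem a x hx) (hprim a x hx)]
  obtain ⟨Δ, hΔ⟩ : ∃ Δ : W →ₗ[ℂ] W ⊗[ℂ] W, ∀ w, inclW (Δ w) = H.comul (W.val w) :=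
    ⟨(LinearEquiv.ofInjective inclW inclW_injective).symm.toLinearMap ∘ₗ
      (H.comul ∘ₗ W.val.toLinearMap).codRestrict (LinearMap.range inclW) hrange, fun w =>
      congrArg Subtype.val ((LinearEquiv.ofInjective inclW inclW_injective).apply_symm_apply _)⟩
  have hval : Function.Injective W.val.toLinearMap := Subtype.val_injective
  obtain ⟨T, hT⟩ : ∃ T : W →ₗ[ℂ] W, ∀ w, W.val (T w) = H.antipode (W.val w) :=
    ⟨(LinearEquiv.ofInjective W.val.toLinearMap hval).symm.toLinearMap ∘ₗ
      (H.antipode ∘ₗ W.val.toLinearMap).codRestrict (LinearMap.range W.val.toLinearMap) hanti,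
      fun w => congrArg Subtype.val
        ((LinearEquiv.ofInjective W.val.toLinearMap hval).apply_symm_apply _)⟩
  refine ⟨.ofGenerators superSign_isCommutationFactor hgen Δ (H.counit.comp W.val) T ?_ ?_ ?_ ?_ ?_,
    ⟨fun w => (hΔ w).symm, fun w => rfl, fun w => (hT w).symm⟩, fun a w hw => ⟨?_, ?_, ?_⟩⟩
  · apply inclW_injective
    rw [hΔ, map_one, H.comul_one]
    simp
  · intro a x hx y
    apply inclW_injective
    rw [hΔ, map_mul, H.comul_primitive_mul hθ (hmem a x hx) (hprim a x hx),
      map_primMul theta_zero_zero val_mem_grade, hΔ]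
  · exact fun a x hx => (hprim a x hx).2.1
  · apply hval
    rw [AlgHom.toLinearMap_apply, hT, map_one, H.antipode_one]
    simp
  · intro a x hx y
    apply hval
    rw [AlgHom.toLinearMap_apply, AlgHom.toLinearMap_apply, hT, map_mul,
      H.antipode_primitive_mul (hmem a x hx) (hprim a x hx),
      map_antiMul theta_zero_zero val_mem_grade, hT]
  · apply inclW_injective
    refine (hΔ w).trans ?_
    rw [(hprim a w hw).1]
    simp
  · exact (hprim a w hw).2.1
  · apply hval
    refine (hT w).trans ?_
    rw [(hprim a w hw).2.2]
    simp

end PBF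

theorem mainTheorem1 {L : Type*} [AddCommGroup L] [Module ℂ L]
    (𝓛 : ZMod 2 → Submodule ℂ L) [DirectSum.Decomposition 𝓛] (S : LieSuperalgebra 𝓛)
    (m n : ℕ) (P : GradedMatrixRep S m n) :
    -- the realization exists, and is unique
    (∃! J : S.U →ₐ[ℂ] PBF, IsParaRealization P J) ∧
    -- the super-Hopf structure of `U(L)`
    (∃! HL : BraidedHopf superSign S.grade, ∀ x : L, HL.PrimitiveAt (S.ι x)) ∧
    -- the `θ`-braided Hopf structure of the relative parabose set
    (∃! HP : BraidedHopf PBF.θ PBF.grade,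
      ∀ (i : ℕ) (ξ : ℤˣ), HP.PrimitiveAt (PBF.B i ξ) ∧ HP.PrimitiveAt (PBF.F i ξ)) ∧
    ∀ J : S.U →ₐ[ℂ] PBF, IsParaRealization P J →
    ∀ HL : BraidedHopf superSign S.grade, (∀ x : L, HL.PrimitiveAt (S.ι x)) →
    ∀ HP : BraidedHopf PBF.θ PBF.grade,
      (∀ (i : ℕ) (ξ : ℤˣ), HP.PrimitiveAt (PBF.B i ξ) ∧ HP.PrimitiveAt (PBF.F i ξ)) →
    -- the structure maps of `HP` restrict to a super-Hopf structure on the subalgebra `W`, and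
    -- `J` is a homomorphism of super-Hopf algebras to `W`
    ∃ HW : BraidedHopf superSign PBF.gradeW, PreservesHopf HW HP PBF.W.val ∧
      ∃ JW : S.U →ₐ[ℂ] PBF.W, PBF.W.val.comp JW = J ∧ IsBraidedHopfHom HL HW JW := by
  refine ⟨existsUnique_isParaRealization P, S.existsUnique_hopf, PBF.existsUnique_hopf,
    fun J hJ HL hHL HP hHP => ?_⟩
  obtain ⟨HW, hHW, hprim⟩ := PBF.exists_hopf_W hHP
  rw [isParaRealization_iff] at hJ
  have hJgen : ∀ a, ∀ u ∈ S.gen a, J u ∈ PBF.lieSpan a := by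
    rintro a _ ⟨x, hx, rfl⟩
    rw [hJ]
    exact PBF.realize_mem_lieSpan (P.isHomogeneous hx)
  have hJW : ∀ u, J u ∈ PBF.W :=
    S.generatesGraded.mem_submodule (N := (Subalgebra.toSubmodule PBF.W).comap J.toLinearMap)
      (by simp) fun a x hx y hy => by
        simp only [Submodule.mem_comap, AlgHom.toLinearMap_apply, map_mul] at hy ⊢
        exact PBF.W.mul_mem (PBF.lieSpan_le_W (hJgen a x hx)) hy
  let JW : S.U →ₐ[ℂ] PBF.W := J.codRestrict PBF.W hJW
  have hgrade : ∀ a, ∀ x ∈ S.grade a, JW x ∈ PBF.gradeW a := fun a =>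
    S.generatesGraded.grade_le (N := fun a => (PBF.gradeW a).comap JW.toLinearMap)
      (by
        simp only [Submodule.mem_comap, AlgHom.toLinearMap_apply, map_one]
        exact SetLike.GradedOne.one_mem)
      (fun a b x hx y hy => by
        simp only [Submodule.mem_comap, AlgHom.toLinearMap_apply, map_mul] at hy ⊢
        exact SetLike.mul_mem_graded (PBF.lieSpan_le_grade a (hJgen a x hx)) hy) a
  refine ⟨HW, hHW, JW, rfl, ?_, hgrade⟩
  refine preservesHopf_of_primitive superSign_isCommutationFactor superSign_isCommutationFactor
    S.generatesGraded (φ := id) (fun _ _ => rfl) hgrade ?_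
    fun a x hx => hprim a (JW x) (hJgen a x hx)
  rintro a _ ⟨x, _, rfl⟩
  exact hHL x
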